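/- Let $\omega_0>0$, $\pi/2<\alpha<\pi$, $\varphi_\pm=\pi\pm\alpha$, and let $Q=\mathbb R^2\setminus\{(x_1,0):x_1\ge 0\}$, i.e. the set of points $x=(\rho\cos\varphi,\rho\sin\varphi)$ with $\rho>0$, $0<\varphi<2\pi$. Let $f\in L^1_{loc}(\mathbb R)$ (complex valued) satisfy $f(s)=0$ for $s<0$, $\sup_s(1+|s|)^p|f(s)|<\infty$ for some $p\in\mathbb R$, and $f(s)\to1$ as $s\to+\infty$; put $F(s)=f(s)e^{-i\omega_0 s}$. With $\mathbf n=(\cos(\pi+\alpha),\sin(\pi+\alpha))=(n_1,n_2)$ and $\overline{\mathbf n}=(n_1,-n_2)$, define for $\rho>0$, $0<\varphi<2\pi$, $\varphi\ne\varphi_\pm$, $t\in\mathbb R$: - the incident wave $u_i=F(t-\mathbf n\cdot x)$, and $u_i^0=u_i$ for $\varphi<\varphi_+$, $u_i^0=0$ for $\varphi>\varphi_+$; - the reflected wave $u_r=-F(t-\overline{\mathbf n}\cdot x)$ for $\varphi<\varphi_-$, $u_r=0$ for $\varphi>\varphi_-$; - the diffracted wave $u_d=\frac{i}{8\pi}\int_{\mathbb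 R}\mathcal Z(\beta,\varphi)\,F(t-\rho\cosh\beta)\,d\beta$, where $\mathcal Z(\beta,\varphi)=Z(\beta+2\pi i-i\varphi)$, $Z(z)=-U(-\frac{i\pi}2+z)+U(-\frac{5i\pi}2+z)$ and $U(\zeta)=\coth\frac{\zeta-i\pi/2+i\alpha}{4}-\coth\frac{\zeta-i\pi/2-i\alpha}{4}$; - the solution $u=u_i^0+u_r+u_d$ of the time-dependent half-plane diffraction problem (Dirichlet condition), and the scattered wave $u_s=u-u_i$. For $\omega\in\mathbb C^+=\{\operatorname{Im}\omega>0\}$ let $\hat u_s(\rho,\varphi,\omega)=\int_0^\infty e^{i\omega t}u_s(\rho,\varphi,t)\,dt$. Then for every $\omega\in\mathbb C^+$ this integral converges absolutely for all $\rho>0$, $\varphi\in(0,2\pi)\setminus\{\varphi_+,\varphi_-\}$, and $\hat u_s(\cdot,\cdot,\omega)$ extends to a function on all of $Q$ (including the rays $\varphi=\varphi_\pm$), still denoted $\hat u_s$, such that $\hat u_s$, $\partial_\rho\hat u_s$ and $\partial_\varphi\hat u_s$ belong to $C^2(Q)$; there are $C(\omega),c(\omega)>0$ such that for all $\rho>0$,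 $\varphi\in(0,2\pi)$ $$|\hat u_s|\le C(\omega)e^{-c(\omega)\rho},\qquad |\partial_\rho\hat u_s|\le C(\omega)e^{-c(\omega)\rho}(1+\rho^{-1/2}),\qquad |\partial_\varphi\hat u_s|\le C(\omega)e^{-c(\omega)\rho}\rho\,(1+\rho^{-1/2});$$ and $(\Delta+\omega^2)\hat u_s=0$ in $Q$. -/

import Mathlib

open Set Filter Topology MeasureTheory

noncomputable section

namespace Sommerfeld

/-- The Euclidean plane, with coordinates `x 0 = x₁` and `x 1 = x₂`. -/
abbrev Plane := EuclideanSpace ℝ (Fin 2)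

/-- The point with polar coordinates `ρ, φ`. -/
def polarPt (ρ φ : ℝ) : Plane := !₂[ρ * Real.cos φ, ρ * Real.sin φ]

/-- The exterior of the screen `{x₂ = 0, x₁ ≥ 0}` (edge included in the screen),
that is the set of points with polar coordinates `ρ > 0`, `0 < φ < 2π`. -/
def Q : Set Plane := {x | ¬ (x 1 = 0 ∧ 0 ≤ x 0)}

/-- `φ₊ = π + α`. -/
def phiPlus (α : ℝ) : ℝ := Real.pi + α

/-- `φ₋ = π - α`. -/
def phiMinus (α : ℝ) : ℝ := Real.pi - α

/-- The hypotheses on a profile function `f`: it is locally integrable, vanishes on the negative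
half-line, `sup (1 + |s|) ^ p |f s| < ∞` for some real `p`, and `f s → 1` as `s → +∞`. -/
structure IsProfile (f : ℝ → ℂ) : Prop where
  locallyIntegrable : LocallyIntegrable f volume
  eq_zero_of_neg : ∀ s : ℝ, s < 0 → f s = 0
  bounded : ∃ p : ℝ, BddAbove (range fun s : ℝ => (1 + |s|) ^ p * ‖f s‖)
  tendsto_one : Tendsto f atTop (𝓝 1)

/-- `F(s) = f(s) e^{-iω₀s}`. -/
def modulated (ω₀ : ℝ) (f : ℝ → ℂ) (s : ℝ) : ℂ :=
  f s * Complex.exp (-Complex.I * ω₀ * s)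

/-- The incident direction `n = (cos (π + α), sin (π + α))`. -/
def dirInc (α : ℝ) : Plane := !₂[Real.cos (Real.pi + α), Real.sin (Real.pi + α)]

/-- The reflected direction `(n₁, -n₂)`. -/
def dirRefl (α : ℝ) : Plane := !₂[Real.cos (Real.pi + α), -Real.sin (Real.pi + α)]

/-- The incident plane wave `u_i(x,t) = e^{-iω₀(t - n·x)} f(t - n·x)`. -/
def uInc (ω₀ α : ℝ) (f : ℝ → ℂ) (x : Plane) (t : ℝ) : ℂ :=
  modulated ω₀ f (t - inner ℝ (dirInc α) x)

/-- The incident wave in the presence of the opaque screen: `u_i` for `φ < φ₊`, and `0` for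
`φ > φ₊`. -/
def uInc0 (ω₀ α : ℝ) (f : ℝ → ℂ) (ρ φ t : ℝ) : ℂ :=
  if φ < phiPlus α then uInc ω₀ α f (polarPt ρ φ) t else 0

/-- The reflected wave: `-e^{-iω₀(t - n'·x)} f(t - n'·x)` for `φ < φ₋`, where `n' = (n₁, -n₂)`,
and `0` for `φ > φ₋`. -/
def uRefl (ω₀ α : ℝ) (f : ℝ → ℂ) (ρ φ t : ℝ) : ℂ :=
  if φ < phiMinus α then
    -modulated ω₀ f (t - inner ℝ (dirRefl α) (polarPt ρ φ))
  else 0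

/-- The hyperbolic cotangent. -/
def coth (z : ℂ) : ℂ := Complex.cosh z / Complex.sinh z

/-- `U(ζ) = coth((ζ - iπ/2 + iα)/4) - coth((ζ - iπ/2 - iα)/4)`. -/
def kernelU (α : ℝ) (ζ : ℂ) : ℂ :=
  coth ((ζ - Complex.I * Real.pi / 2 + Complex.I * α) / 4)
    - coth ((ζ - Complex.I * Real.pi / 2 - Complex.I * α) / 4)

/-- `Z(z) = -U(-iπ/2 + z) + U(-5iπ/2 + z)`. -/
def kernelZ (α : ℝ) (z : ℂ) : ℂ :=
  -kernelU α (-(Complex.I * Real.pi / 2) + z) + kernelU α (-(5 * Complex.I * Real.pi / 2) + z)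

/-- `𝒵(β,φ) = Z(β + 2πi - iφ)`. -/
def kernelPolar (α β φ : ℝ) : ℂ :=
  kernelZ α (β + 2 * Real.pi * Complex.I - Complex.I * φ)

/-- The wave diffracted by the edge,
`u_d(ρ,φ,t) = (i/8π) ∫_ℝ 𝒵(β,φ) F(t - ρ cosh β) dβ` (for `φ ≠ φ₊, φ₋`). -/
def uDiffr (ω₀ α : ℝ) (f : ℝ → ℂ) (ρ φ t : ℝ) : ℂ :=
  Complex.I / (8 * Real.pi) *
    ∫ β : ℝ, kernelPolar α β φ * modulated ω₀ f (t - ρ * Real.cosh β)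

/-- The solution `u = u_i⁰ + u_r + u_d` of the time-dependent diffraction problem
(for `φ ≠ φ₊, φ₋`). -/
def uTotal (ω₀ α : ℝ) (f : ℝ → ℂ) (ρ φ t : ℝ) : ℂ :=
  uInc0 ω₀ α f ρ φ t + uRefl ω₀ α f ρ φ t + uDiffr ω₀ α f ρ φ t

/-- The scattered wave `u_s = u - u_i` (for `φ ≠ φ₊, φ₋`). -/
def uScat (ω₀ α : ℝ) (f : ℝ → ℂ) (ρ φ t : ℝ) : ℂ :=
  uTotal ω₀ α f ρ φ t - uInc ω₀ α f (polarPt ρ φ) t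

/-- Absolute convergence of the Fourier-Laplace integral of `h` at `ω`. -/
def FourierLaplaceConverges (h : ℝ → ℂ) (ω : ℂ) : Prop :=
  IntegrableOn (fun t : ℝ => Complex.exp (Complex.I * ω * t) * h t) (Ioi 0) volume

/-- The Fourier-Laplace transform `ĥ(ω) = ∫₀^∞ e^{iωt} h(t) dt`. -/
def fourierLaplace (h : ℝ → ℂ) (ω : ℂ) : ℂ :=
  ∫ t in Ioi (0 : ℝ), Complex.exp (Complex.I * ω * t) * h t

/-- The derivative `∂_ρ v` in polar coordinates, as a function on the plane. -/
def dRho (v : Plane → ℂ) (x : Plane) : ℂ := fderiv ℝ v x (‖x‖⁻¹ • x)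

/-- The derivative `∂_φ v` in polar coordinates, as a function on the plane. -/
def dPhi (v : Plane → ℂ) (x : Plane) : ℂ := fderiv ℝ v x !₂[-x 1, x 0]

theorem norm_polarPt {ρ : ℝ} (hρ : 0 < ρ) (φ : ℝ) : ‖polarPt ρ φ‖ = ρ := by
  rw [EuclideanSpace.norm_eq]
  simp only [polarPt, Fin.sum_univ_two, Real.norm_eq_abs, sq_abs]
  simp only [Matrix.cons_val_zero, Matrix.cons_val_one]
  rw [show (ρ * Real.cos φ) ^ 2 + (ρ * Real.sin φ) ^ 2 = ρ ^ 2 by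
    nlinarith [Real.sin_sq_add_cos_sq φ], Real.sqrt_sq hρ.le]

theorem hasDerivAt_dRho (v : Plane → ℂ) {ρ : ℝ} (hρ : 0 < ρ) (φ : ℝ)
    (hv : DifferentiableAt ℝ v (polarPt ρ φ)) :
    HasDerivAt (fun r => v (polarPt r φ)) (dRho v (polarPt ρ φ)) ρ := by
  have hg : HasDerivAt (fun r => ![r * Real.cos φ, r * Real.sin φ])
      ![Real.cos φ, Real.sin φ] ρ := by
    rw [hasDerivAt_pi]
    intro i
    fin_cases i
    · simpa using (hasDerivAt_id ρ).mul_const (Real.cos φ)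
    · simpa using (hasDerivAt_id ρ).mul_const (Real.sin φ)
  have h : HasDerivAt (fun r => polarPt r φ) !₂[Real.cos φ, Real.sin φ] ρ :=
    (PiLp.continuousLinearEquiv 2 ℝ
      (fun _ : Fin 2 => ℝ)).symm.toContinuousLinearMap.hasFDerivAt.comp_hasDerivAt ρ hg
  have he : !₂[Real.cos φ, Real.sin φ] = ‖polarPt ρ φ‖⁻¹ • polarPt ρ φ := by
    rw [norm_polarPt hρ]
    ext i
    fin_cases i <;> simp [polarPt, hρ.ne']
  rw [he] at h
  exact hv.hasFDerivAt.comp_hasDerivAt ρ h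

theorem hasDerivAt_dPhi (v : Plane → ℂ) (ρ φ : ℝ)
    (hv : DifferentiableAt ℝ v (polarPt ρ φ)) :
    HasDerivAt (fun p => v (polarPt ρ p)) (dPhi v (polarPt ρ φ)) φ := by
  have hg : HasDerivAt (fun p => ![ρ * Real.cos p, ρ * Real.sin p])
      ![-(ρ * Real.sin φ), ρ * Real.cos φ] φ := by
    rw [hasDerivAt_pi]
    intro i
    fin_cases i
    · simpa using (Real.hasDerivAt_cos φ).const_mul ρ
    · simpa using (Real.hasDerivAt_sin φ).const_mul ρ
  have h : HasDerivAt (fun p => polarPt ρ p) !₂[-(polarPt ρ φ) 1, (polarPt ρ φ) 0] φ :=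
    (PiLp.continuousLinearEquiv 2 ℝ
      (fun _ : Fin 2 => ℝ)).symm.toContinuousLinearMap.hasFDerivAt.comp_hasDerivAt φ hg
  exact hv.hasFDerivAt.comp_hasDerivAt φ h

end Sommerfeld

end

noncomputable section

namespace Sommerfeld

/-! The transform of the scattered wave has a closed form. A delay by `τ > 0` becomes the factor
`e^{iωτ}`, so the diffracted wave becomes the profile transform times a `β`-integral of the kernel
against `e^{iωρ cosh β}`. The four hyperbolic cotangents of the kernel collapse to two reciprocals
`1 / cosh ((β - ia)/2)`, with `a = φ ∓ α`. Symmetrising in `β` and substituting `s = sinh (β/2)`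
gives a Gaussian-damped Lorentz integral, which is an error function (`lorentzGauss_eq_cerfc`,
`integral_sechExp`).

These error functions jump where `cos ((φ ∓ α)/2)` changes sign, that is on the rays `φ = φ₊` and `φ
= φ₋`. The jumps are exactly those of the plane-wave terms, up to sign, by `cerfc (-z) = 2 - cerfc
z`. What remains is `scatHat`, a multiple of the sum of two edge waves `e^{-iωℓ} erfc (±κ Re S)`,
where `κ² = -2iω`, `Re κ > 0`, `S` is a branch of the square root of `e^{-iθ}(x₁ + i x₂)` and `ℓ =
Re S²` (`hasFourierLaplace_uScat`).

Since `S` is holomorphic off the screen, each edge wave is smooth on `Q` and solves the Helmholtz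
equation (`laplacian_edgeWave`). It decays because of the error function where the argument lies in
the right half-plane. In the remaining sector the plane wave itself decays, as `ℓ ≤ ρ cos α` and
`cos α < 0`. The derivative of `S` has size `1/(2√ρ)`, which is the source of the edge singularity
`ρ^{-1/2}`. -/

/-! ### The complex error function. -/

/-- The complementary error function on the complex plane. -/
def cerfc (z : ℂ) : ℂ :=
  1 - (2 / √Real.pi : ℝ) * ∫ t in (0 : ℝ)..1, z * Complex.exp (-(z ^ 2 * t ^ 2))

/-- Writing the path integral over the fixed interval `[0, 1]` allows differentiation under the
integral sign for complex `z`. -/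
theorem hasDerivAt_cerfc (z : ℂ) :
    HasDerivAt cerfc (-((2 / √Real.pi : ℝ) * Complex.exp (-z ^ 2))) z := by
  set g : ℂ → ℝ → ℂ := fun w t => w * Complex.exp (-(w ^ 2 * t ^ 2)) with hg
  set g' : ℂ → ℝ → ℂ := fun w t =>
    Complex.exp (-(w ^ 2 * t ^ 2)) + w * (Complex.exp (-(w ^ 2 * t ^ 2)) * -(2 * w * t ^ 2)) with hg'
  have hc : Continuous (fun p : ℂ × ℝ => g' p.1 p.2) := by fun_prop
  obtain ⟨B, hB⟩ := ((isCompact_closedBall z 1).prod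
    (isCompact_Icc (a := (0 : ℝ)) (b := 1))).exists_bound_of_continuousOn hc.continuousOn
  have hd : ∀ w t, HasDerivAt (fun w => g w t) (g' w t) w := by
    intro w t
    have h1 : HasDerivAt (fun w : ℂ => -(w ^ 2 * (t : ℂ) ^ 2)) (-(2 * w * (t : ℂ) ^ 2)) w := by
      simpa using! ((hasDerivAt_pow 2 w).mul_const ((t : ℂ) ^ 2)).neg
    simpa [hg, hg'] using! (hasDerivAt_id w).mul h1.cexp
  have key := (intervalIntegral.hasDerivAt_integral_of_dominated_loc_of_deriv_le
    (μ := volume) (F := g) (F' := g') (x₀ := z) (a := 0) (b := 1) (bound := fun _ => B)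
    (Metric.ball_mem_nhds z one_pos)
    (Eventually.of_forall fun w => by
      have : Continuous (g w) := by simp only [hg]; fun_prop
      exact this.aestronglyMeasurable)
    (by
      have : Continuous (g z) := by simp only [hg]; fun_prop
      exact this.intervalIntegrable 0 1)
    (by
      have : Continuous (g' z) := by simp only [hg']; fun_prop
      exact this.aestronglyMeasurable)
    (Eventually.of_forall fun t ht w hw => by
      rw [uIoc_of_le zero_le_one] at ht
      exact hB (w, t) ⟨Metric.ball_subset_closedBall hw, ht.1.le, ht.2⟩)
    intervalIntegrable_const
    (Eventually.of_forall fun t _ w _ => hd w t)).2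
  -- The `z`-derivative of the integrand is also the `t`-derivative of `t e^{-z²t²}`, so only the
  -- endpoint `t = 1` contributes.
  have hval : ∫ t in (0 : ℝ)..1, g' z t = Complex.exp (-z ^ 2) := by
    have hprim : ∀ t : ℝ, HasDerivAt (fun t : ℝ => (t : ℂ) * Complex.exp (-(z ^ 2 * (t : ℂ) ^ 2)))
        (g' z t) t := by
      intro t
      have h0 : HasDerivAt (fun t : ℝ => (t : ℂ)) 1 t := Complex.ofRealCLM.hasDerivAt
      have h1 : HasDerivAt (fun t : ℝ => -(z ^ 2 * (t : ℂ) ^ 2)) (-(z ^ 2 * (2 * t))) t := by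
        simpa using! ((h0.pow 2).const_mul (z ^ 2)).neg
      have := h0.mul h1.cexp
      refine this.congr_deriv ?_
      simp only [hg']
      ring
    rw [intervalIntegral.integral_eq_sub_of_hasDerivAt (fun t _ => hprim t)
      (by
        have : Continuous (g' z) := by simp only [hg']; fun_prop
        exact this.intervalIntegrable 0 1)]
    simp
  rw [hval] at key
  exact (key.const_mul _).const_sub 1

@[simp] theorem cerfc_zero : cerfc 0 = 1 := by simp [cerfc]

theorem cerfc_neg (z : ℂ) : cerfc (-z) = 2 - cerfc z := by
  simp [cerfc]
  ring

theorem contDiff_cerfc {n : WithTop ℕ∞} : ContDiff ℂ n cerfc :=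
  Differentiable.contDiff fun z => (hasDerivAt_cerfc z).differentiableAt

/-! ### The Gaussian-damped Lorentz integral. -/

theorem integrable_lorentz {c : ℝ} (hc : 0 < c) :
    Integrable (fun s : ℝ => c / (s ^ 2 + c ^ 2)) := by
  have h := (integrable_inv_one_add_sq.comp_mul_left' (inv_ne_zero hc.ne')).const_mul c⁻¹
  refine h.congr (Eventually.of_forall fun s => ?_)
  simp only
  field_simp
  ring

theorem integral_lorentz {c : ℝ} (hc : 0 < c) :
    ∫ s : ℝ, c / (s ^ 2 + c ^ 2) = Real.pi := by
  have h := Measure.integral_comp_mul_left (fun x : ℝ => (1 + x ^ 2)⁻¹) c⁻¹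
  rw [integral_univ_inv_one_add_sq, inv_inv, abs_of_pos hc, smul_eq_mul] at h
  have h2 : ∀ s : ℝ, c / (s ^ 2 + c ^ 2) = c⁻¹ * (1 + (c⁻¹ * s) ^ 2)⁻¹ := by
    intro s
    field_simp
    ring
  simp_rw [h2]
  rw [integral_const_mul, h]
  field_simp

/-- The Gaussian-damped Lorentz integral `∫ c / (s² + c²) e^{-b (s² + c²)} ds`. -/
def lorentzGauss (c : ℝ) (b : ℂ) : ℂ :=
  ∫ s : ℝ, ((c / (s ^ 2 + c ^ 2) : ℝ) : ℂ) * Complex.exp (-b * ((s ^ 2 + c ^ 2 : ℝ) : ℂ))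

theorem norm_exp_neg_mul_real (b : ℂ) (x : ℝ) :
    ‖Complex.exp (-b * (x : ℂ))‖ = Real.exp (-(b.re * x)) := by
  rw [Complex.norm_exp]
  simp

theorem norm_lorentzGauss_integrand_le {c : ℝ} (hc : 0 < c) {b : ℂ} (hb : 0 ≤ b.re) (s : ℝ) :
    ‖((c / (s ^ 2 + c ^ 2) : ℝ) : ℂ) * Complex.exp (-b * ((s ^ 2 + c ^ 2 : ℝ) : ℂ))‖
      ≤ Real.exp (-(b.re * c ^ 2)) * (c / (s ^ 2 + c ^ 2)) := by
  have hpos : 0 < c / (s ^ 2 + c ^ 2) := by positivity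
  rw [norm_mul, norm_exp_neg_mul_real, Complex.norm_real, Real.norm_of_nonneg hpos.le, mul_comm]
  gcongr
  nlinarith [sq_nonneg s]

theorem continuous_lorentzGauss_integrand {c : ℝ} (hc : 0 < c) (b : ℂ) :
    Continuous fun s : ℝ =>
      ((c / (s ^ 2 + c ^ 2) : ℝ) : ℂ) * Complex.exp (-b * ((s ^ 2 + c ^ 2 : ℝ) : ℂ)) := by
  have h : ∀ s : ℝ, s ^ 2 + c ^ 2 ≠ 0 := fun s => by positivity
  have : Continuous fun s : ℝ => c / (s ^ 2 + c ^ 2) := by fun_prop (disch := exact h)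
  fun_prop

theorem norm_lorentzGauss_le {c : ℝ} (hc : 0 < c) {b : ℂ} (hb : 0 ≤ b.re) :
    ‖lorentzGauss c b‖ ≤ Real.pi * Real.exp (-(b.re * c ^ 2)) := by
  refine (norm_integral_le_of_norm_le ((integrable_lorentz hc).const_mul _)
    (Eventually.of_forall fun s => norm_lorentzGauss_integrand_le hc hb s)).trans_eq ?_
  rw [integral_const_mul, integral_lorentz hc, mul_comm]

theorem integrable_lorentzGauss {c : ℝ} (hc : 0 < c) {b : ℂ} (hb : 0 ≤ b.re) :
    Integrable fun s : ℝ =>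
      ((c / (s ^ 2 + c ^ 2) : ℝ) : ℂ) * Complex.exp (-b * ((s ^ 2 + c ^ 2 : ℝ) : ℂ)) :=
  ((integrable_lorentz hc).const_mul _).mono'
    (continuous_lorentzGauss_integrand hc b).aestronglyMeasurable
    (Eventually.of_forall fun s => norm_lorentzGauss_integrand_le hc hb s)

/-- Differentiation in `r` cancels the Lorentz denominator and leaves a pure Gaussian integral. The
majorant is uniform on `r' > r/2`. -/
theorem hasDerivAt_lorentzGauss {c : ℝ} (hc : 0 < c) {b : ℂ} (hb : 0 < b.re) {r : ℝ} (hr : 0 < r) :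
    HasDerivAt (fun r : ℝ => lorentzGauss c (b * r))
      (-(c * b * Complex.exp (-(b * r * c ^ 2)) * (Real.pi / (b * r)) ^ (1 / 2 : ℂ))) r := by
  set F : ℝ → ℝ → ℂ := fun r s =>
    ((c / (s ^ 2 + c ^ 2) : ℝ) : ℂ) * Complex.exp (-(b * r) * ((s ^ 2 + c ^ 2 : ℝ) : ℂ)) with hF
  set F' : ℝ → ℝ → ℂ := fun r s =>
    -(c * b) * Complex.exp (-(b * r) * ((s ^ 2 + c ^ 2 : ℝ) : ℂ)) with hF'
  have hbr : 0 < b.re * (r / 2) := by positivity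
  have key := (hasDerivAt_integral_of_dominated_loc_of_deriv_le (μ := volume) (F := F) (F' := F')
    (x₀ := r) (s := Ioi (r / 2))
    (bound := fun s => ‖(c : ℂ) * b‖ * Real.exp (-(b.re * (r / 2)) * s ^ 2))
    (Ioi_mem_nhds (by linarith))
    (Eventually.of_forall fun w =>
      (continuous_lorentzGauss_integrand hc (b * w)).aestronglyMeasurable)
    (integrable_lorentzGauss hc (b := b * r) (by simp; positivity))
    (by
      have : Continuous (F' r) := by simp only [hF']; fun_prop
      exact this.aestronglyMeasurable)
    (Eventually.of_forall fun s w hw => by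
      simp only [hF', norm_mul, norm_neg, norm_exp_neg_mul_real]
      gcongr
      have hw' : r / 2 < w := hw
      simp only [Complex.mul_re, Complex.ofReal_re, Complex.ofReal_im, mul_zero, sub_zero]
      have h1 : b.re * (r / 2) ≤ b.re * w := by gcongr
      nlinarith [sq_nonneg s, sq_nonneg c, mul_le_mul_of_nonneg_right h1 (sq_nonneg s),
        mul_nonneg (hbr.le.trans h1) (sq_nonneg c)])
    ((integrable_exp_neg_mul_sq hbr).const_mul _)
    (Eventually.of_forall fun s w _ => by
      have h0 : HasDerivAt (fun t : ℝ => (t : ℂ)) 1 w := Complex.ofRealCLM.hasDerivAt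
      have h1 : HasDerivAt (fun t : ℝ => -(b * t) * ((s ^ 2 + c ^ 2 : ℝ) : ℂ))
          (-b * ((s ^ 2 + c ^ 2 : ℝ) : ℂ)) w := by
        refine (((h0.const_mul b).neg.mul_const ((s ^ 2 + c ^ 2 : ℝ) : ℂ))).congr_deriv ?_
        rw [mul_one]
      refine (h1.cexp.const_mul ((c / (s ^ 2 + c ^ 2) : ℝ) : ℂ)).congr_deriv ?_
      have hne : ((s : ℂ) ^ 2 + (c : ℂ) ^ 2) ≠ 0 := by
        have : s ^ 2 + c ^ 2 ≠ 0 := by positivity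
        exact_mod_cast this
      simp only [hF']
      push_cast
      field_simp)).2
  refine key.congr_deriv ?_
  have hsplit : ∀ s : ℝ, F' r s =
      -(c * b * Complex.exp (-(b * r * c ^ 2))) * Complex.exp (-(b * r) * (s : ℂ) ^ 2) := by
    intro s
    simp only [hF']
    have : -(b * r) * ((s ^ 2 + c ^ 2 : ℝ) : ℂ) = -(b * r * c ^ 2) + -(b * r) * (s : ℂ) ^ 2 := by
      push_cast; ring
    rw [this, Complex.exp_add]
    ring
  simp_rw [hsplit]
  rw [integral_const_mul, integral_gaussian_complex (by simp; positivity)]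
  ring

/-- The candidate root has positive real part, so its argument lies in the range where the principal
square root undoes squaring. -/
theorem pi_div_cpow_half {κ : ℂ} (hκ : 0 < κ.re) {r : ℝ} (hr : 0 < r) :
    ((Real.pi : ℂ) / (κ ^ 2 * r)) ^ (1 / 2 : ℂ) = (√Real.pi : ℝ) / (κ * (√r : ℝ)) := by
  have hκ0 : κ ≠ 0 := by rintro rfl; simp at hκ
  have h1 : (Real.pi : ℂ) / (κ ^ 2 * r) = ((√Real.pi : ℝ) / (κ * (√r : ℝ))) ^ 2 := by
    rw [div_pow, mul_pow, ← Complex.ofReal_pow, ← Complex.ofReal_pow, Real.sq_sqrt Real.pi_pos.le,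
      Real.sq_sqrt hr.le]
  have hre : 0 < ((√Real.pi : ℝ) / (κ * (√r : ℝ)) : ℂ).re := by
    have : ((√Real.pi : ℝ) / (κ * (√r : ℝ)) : ℂ) = ((√Real.pi / √r : ℝ) : ℂ) * κ⁻¹ := by
      push_cast
      field_simp
    rw [this, Complex.re_ofReal_mul, Complex.inv_re]
    have := Complex.normSq_pos.2 hκ0
    have := Real.pi_pos
    positivity
  rw [h1]
  have harg := Complex.abs_arg_lt_pi_div_two_iff.2 (Or.inl hre)
  rw [abs_lt] at harg
  have := Complex.pow_cpow_nat_inv (x := (√Real.pi : ℝ) / (κ * (√r : ℝ))) (n := 2) two_ne_zero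
    (by push_cast; linarith [harg.1]) (by push_cast; linarith [harg.2])
  simpa using this

/-- The Gaussian-damped Lorentz integral is an error function. -/
theorem lorentzGauss_eq_cerfc {c : ℝ} (hc : 0 < c) {κ : ℂ} (hκ : 0 < κ.re) (hκ2 : 0 < (κ ^ 2).re)
    {r : ℝ} (hr : 0 ≤ r) :
    lorentzGauss c (κ ^ 2 * r) = Real.pi * cerfc (κ * (√r : ℝ) * c) := by
  -- The difference of the two sides has zero derivative for `r > 0`, is continuous on `r ≥ 0`, and
  -- vanishes at `r = 0`, where both sides equal `π`.
  set D : ℝ → ℂ := fun r => lorentzGauss c (κ ^ 2 * r) - Real.pi * cerfc (κ * (√r : ℝ) * c) with hD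
  have hderiv : ∀ x : ℝ, 0 < x → HasDerivAt D 0 x := by
    intro x hx
    have h1 := hasDerivAt_lorentzGauss hc hκ2 hx
    rw [pi_div_cpow_half hκ hx] at h1
    have h2 : HasDerivAt (fun r : ℝ => κ * ((√r : ℝ) : ℂ) * c) (κ * ((1 / (2 * √x) : ℝ) : ℂ) * c) x :=
      (((Real.hasDerivAt_sqrt hx.ne').ofReal_comp).const_mul κ).mul_const (c : ℂ)
    have h3 := ((hasDerivAt_cerfc (κ * (√x : ℝ) * c)).comp x h2).const_mul (Real.pi : ℂ)
    refine (h1.sub h3).congr_deriv ?_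
    have hκ0 : κ ≠ 0 := by rintro rfl; simp at hκ
    have hsx : ((√x : ℝ) : ℂ) ≠ 0 := by exact_mod_cast (Real.sqrt_pos.2 hx).ne'
    have hsp : ((√Real.pi : ℝ) : ℂ) ≠ 0 := by exact_mod_cast (Real.sqrt_pos.2 Real.pi_pos).ne'
    have e1 : -(κ * ((√x : ℝ) : ℂ) * c) ^ 2 = -(κ ^ 2 * x * c ^ 2) := by
      have : (x : ℂ) = ((√x : ℝ) : ℂ) ^ 2 := by rw [← Complex.ofReal_pow, Real.sq_sqrt hx.le]
      rw [this]; ring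
    have e2 : (Real.pi : ℂ) = ((√Real.pi : ℝ) : ℂ) ^ 2 := by
      rw [← Complex.ofReal_pow, Real.sq_sqrt Real.pi_pos.le]
    rw [e1, e2]
    push_cast
    field_simp
    ring
  have hcont : ContinuousOn D (Ici 0) := by
    refine ContinuousOn.sub ?_ ?_
    · refine continuousOn_of_dominated (bound := fun s => c / (s ^ 2 + c ^ 2))
        (fun x _ => (continuous_lorentzGauss_integrand hc _).aestronglyMeasurable)
        (fun x hx => Eventually.of_forall fun s => ?_) (integrable_lorentz hc)
        (Eventually.of_forall fun s => by fun_prop)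
      have hre : 0 ≤ (κ ^ 2 * x : ℂ).re := by
        simpa using mul_nonneg hκ2.le hx
      refine (norm_lorentzGauss_integrand_le hc hre s).trans ?_
      refine mul_le_of_le_one_left (by positivity) (Real.exp_le_one_iff.2 ?_)
      have := mul_nonneg hre (sq_nonneg c)
      linarith
    · have : Continuous cerfc := contDiff_cerfc (n := 0).continuous
      fun_prop
  have h0 : D 0 = 0 := by
    have : ∀ s : ℝ, ((c / (s ^ 2 + c ^ 2) : ℝ) : ℂ)
        * Complex.exp (-(κ ^ 2 * ((0 : ℝ) : ℂ)) * ((s ^ 2 + c ^ 2 : ℝ) : ℂ))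
        = ((c / (s ^ 2 + c ^ 2) : ℝ) : ℂ) := by simp
    simp_rw [hD, lorentzGauss, this]
    rw [integral_complex_ofReal, integral_lorentz hc]
    simp
  rcases hr.eq_or_lt with rfl | hr'
  · exact sub_eq_zero.1 h0
  · have hev : D =ᶠ[𝓝[>] 0] fun _ => D r := by
      filter_upwards [Ioo_mem_nhdsGT hr'] with δ hδ
      exact (constant_of_has_deriv_right_zero (hcont.mono (Icc_subset_Ici_iff hδ.2.le |>.2 hδ.1.le))
        (fun x hx => (hderiv x (hδ.1.trans_le hx.1)).hasDerivWithinAt) r ⟨hδ.2.le, le_rfl⟩).symm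
    have hlim : Tendsto D (𝓝[>] 0) (𝓝 (D 0)) :=
      (hcont 0 self_mem_Ici).mono_left (nhdsWithin_mono 0 Ioi_subset_Ici_self)
    have := tendsto_nhds_unique (hlim.congr' hev) tendsto_const_nhds
    rw [h0] at this
    exact sub_eq_zero.1 this.symm

/-- The Lorentz representation at `r = 1`, `c = h` turns the trivial bound on the integral into
Gaussian decay with constant `1`. -/
theorem norm_cerfc_le {κ : ℂ} (hκ : 0 < κ.re) (hκ2 : 0 < (κ ^ 2).re) {h : ℝ} (hh : 0 ≤ h) :
    ‖cerfc (κ * h)‖ ≤ Real.exp (-((κ ^ 2).re * h ^ 2)) := by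
  rcases hh.eq_or_lt with rfl | hh
  · simp
  have h1 := lorentzGauss_eq_cerfc hh hκ hκ2 zero_le_one
  have h2 := norm_lorentzGauss_le hh (b := κ ^ 2) hκ2.le
  simp only [Complex.ofReal_one, mul_one, Real.sqrt_one] at h1
  rw [h1, norm_mul, Complex.norm_real, Real.norm_of_nonneg Real.pi_pos.le] at h2
  exact le_of_mul_le_mul_left h2 Real.pi_pos

/-! ### The Sommerfeld kernel and its integral over `β`. -/

theorem coth_add_sub_coth_sub (w : ℂ) (hw : Complex.cosh (2 * w) ≠ 0) :
    coth (w + Complex.I * (Real.pi / 4 : ℝ)) - coth (w - Complex.I * (Real.pi / 4 : ℝ))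
      = -2 * Complex.I / Complex.cosh (2 * w) := by
  have hc : Complex.cosh (Complex.I * (Real.pi / 4 : ℝ)) = (√2 / 2 : ℝ) := by
    rw [mul_comm, Complex.cosh_mul_I, ← Complex.ofReal_cos, Real.cos_pi_div_four]
  have hs : Complex.sinh (Complex.I * (Real.pi / 4 : ℝ)) = (√2 / 2 : ℝ) * Complex.I := by
    rw [mul_comm, Complex.sinh_mul_I, ← Complex.ofReal_sin, Real.sin_pi_div_four]
  have hr : ((√2 / 2 : ℝ) : ℂ) ≠ 0 := by
    have : (√2 / 2 : ℝ) ≠ 0 := by positivity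
    exact_mod_cast this
  have hI := Complex.I_sq
  have hsq := Complex.cosh_sq w
  have h2 : Complex.cosh (2 * w)
      = (Complex.sinh w + Complex.I * Complex.cosh w) * (Complex.sinh w - Complex.I * Complex.cosh w) := by
    rw [Complex.cosh_two_mul]
    linear_combination (Complex.cosh w ^ 2) * hI
  rw [h2] at hw ⊢
  have hp := left_ne_zero_of_mul hw
  have hm := right_ne_zero_of_mul hw
  have e1 : coth (w + Complex.I * (Real.pi / 4 : ℝ))
      = (Complex.cosh w + Complex.I * Complex.sinh w) / (Complex.sinh w + Complex.I * Complex.cosh w) := by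
    rw [coth, Complex.cosh_add, Complex.sinh_add, hc, hs,
      ← mul_div_mul_left (Complex.cosh w + Complex.I * Complex.sinh w) _ hr]
    congr 1 <;> ring
  have e2 : coth (w - Complex.I * (Real.pi / 4 : ℝ))
      = (Complex.cosh w - Complex.I * Complex.sinh w) / (Complex.sinh w - Complex.I * Complex.cosh w) := by
    rw [coth, Complex.cosh_sub, Complex.sinh_sub, hc, hs,
      ← mul_div_mul_left (Complex.cosh w - Complex.I * Complex.sinh w) _ hr]
    congr 1 <;> ring
  rw [e1, e2, div_sub_div _ _ hp hm]
  congr 1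
  linear_combination (-2 * Complex.I) * hsq

theorem cosh_half_sub (β a : ℝ) : Complex.cosh ((β - Complex.I * a) / 2)
    = (Real.cosh (β / 2) * Real.cos (a / 2) : ℝ)
      - (Real.sinh (β / 2) * Real.sin (a / 2) : ℝ) * Complex.I := by
  have : ((β : ℂ) - Complex.I * a) / 2 = ((β / 2 : ℝ) : ℂ) - ((a / 2 : ℝ) : ℂ) * Complex.I := by
    push_cast; ring
  rw [this, Complex.cosh_sub, Complex.cosh_mul_I, Complex.sinh_mul_I]
  push_cast
  ring

theorem normSq_cosh_half_sub (β a : ℝ) : Complex.normSq (Complex.cosh ((β - Complex.I * a) / 2))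
    = Real.sinh (β / 2) ^ 2 + Real.cos (a / 2) ^ 2 := by
  rw [cosh_half_sub, Complex.normSq_apply]
  simp only [Complex.sub_re, Complex.ofReal_re, Complex.mul_re, Complex.I_re, mul_zero,
    Complex.ofReal_im, Complex.I_im, mul_one, sub_self, sub_zero, Complex.sub_im, Complex.mul_im,
    zero_sub, add_zero]
  have h1 := Real.cosh_sq (β / 2)
  have h2 := Real.sin_sq (a / 2)
  linear_combination (Real.cos (a / 2) ^ 2) * h1 + (Real.sinh (β / 2) ^ 2) * h2

theorem cosh_half_sub_ne_zero {a : ℝ} (ha : Real.cos (a / 2) ≠ 0) (β : ℝ) :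
    Complex.cosh ((β - Complex.I * a) / 2) ≠ 0 := by
  rw [← Complex.normSq_pos, normSq_cosh_half_sub]
  positivity

/-- Among the four cotangents, the two with the same sign of `α` have arguments differing by `iπ/2`,
so each pair collapses to one reciprocal cosh. -/
theorem kernelPolar_eq (α φ β : ℝ) (hm : Real.cos ((φ - α) / 2) ≠ 0)
    (hp : Real.cos ((φ + α) / 2) ≠ 0) :
    kernelPolar α β φ = 2 * Complex.I * ((Complex.cosh ((β - Complex.I * (φ - α : ℝ)) / 2))⁻¹
      - (Complex.cosh ((β - Complex.I * (φ + α : ℝ)) / 2))⁻¹) := by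
  have h1 := coth_add_sub_coth_sub ((β - Complex.I * (φ - α : ℝ)) / 4) (by
    convert cosh_half_sub_ne_zero hm β using 2; ring)
  have h2 := coth_add_sub_coth_sub ((β - Complex.I * (φ + α : ℝ)) / 4) (by
    convert cosh_half_sub_ne_zero hp β using 2; ring)
  have e : ∀ a : ℝ, 2 * (((β : ℂ) - Complex.I * a) / 4) = (β - Complex.I * a) / 2 := by
    intro a; ring
  rw [e] at h1 h2
  rw [kernelPolar, kernelZ, kernelU, kernelU]
  have a1 : (-(Complex.I * Real.pi / 2) + (β + 2 * Real.pi * Complex.I - Complex.I * φ)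
      - Complex.I * Real.pi / 2 + Complex.I * α) / 4
      = (β - Complex.I * (φ - α : ℝ)) / 4 + Complex.I * (Real.pi / 4 : ℝ) := by push_cast; ring
  have a2 : (-(Complex.I * Real.pi / 2) + (β + 2 * Real.pi * Complex.I - Complex.I * φ)
      - Complex.I * Real.pi / 2 - Complex.I * α) / 4
      = (β - Complex.I * (φ + α : ℝ)) / 4 + Complex.I * (Real.pi / 4 : ℝ) := by push_cast; ring
  have a3 : (-(5 * Complex.I * Real.pi / 2) + (β + 2 * Real.pi * Complex.I - Complex.I * φ)
      - Complex.I * Real.pi / 2 + Complex.I * α) / 4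
      = (β - Complex.I * (φ - α : ℝ)) / 4 - Complex.I * (Real.pi / 4 : ℝ) := by push_cast; ring
  have a4 : (-(5 * Complex.I * Real.pi / 2) + (β + 2 * Real.pi * Complex.I - Complex.I * φ)
      - Complex.I * Real.pi / 2 - Complex.I * α) / 4
      = (β - Complex.I * (φ + α : ℝ)) / 4 - Complex.I * (Real.pi / 4 : ℝ) := by push_cast; ring
  rw [a1, a2, a3, a4]
  linear_combination h2 - h1

theorem one_add_half_sq_le_cosh (β : ℝ) : 1 + β ^ 2 / 2 ≤ Real.cosh β := by
  have h : |β / 2| ≤ |Real.sinh (β / 2)| := by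
    rw [Real.abs_sinh]
    exact Real.self_le_sinh_iff.2 (abs_nonneg _)
  have h2 := sq_le_sq.2 h
  have h3 := Real.cosh_two_mul (β / 2)
  have h4 := Real.cosh_sq (β / 2)
  rw [mul_div_cancel₀ β two_ne_zero] at h3
  nlinarith

/-- The integrand of the Sommerfeld integral with one pole family. -/
def sechExp (ω : ℂ) (ρ a β : ℝ) : ℂ :=
  (Complex.cosh ((β - Complex.I * a) / 2))⁻¹ * Complex.exp (Complex.I * ω * (ρ * Real.cosh β : ℝ))

theorem integrable_sechExp {ω : ℂ} (hω : 0 < ω.im) {ρ : ℝ} (hρ : 0 < ρ) {a : ℝ}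
    (ha : Real.cos (a / 2) ≠ 0) : Integrable (sechExp ω ρ a) := by
  have hne := cosh_half_sub_ne_zero ha
  have hcont : Continuous (sechExp ω ρ a) := by
    unfold sechExp
    fun_prop (disch := exact hne)
  have hpos : 0 < ω.im * ρ / 2 := by positivity
  refine ((integrable_exp_neg_mul_sq hpos).const_mul |Real.cos (a / 2)|⁻¹).mono'
    hcont.aestronglyMeasurable (Eventually.of_forall fun β => ?_)
  rw [sechExp, norm_mul, norm_inv]
  have h1 : |Real.cos (a / 2)| ≤ ‖Complex.cosh ((β - Complex.I * a) / 2)‖ := by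
    rw [← abs_of_nonneg (norm_nonneg (Complex.cosh _)), ← sq_le_sq, Complex.sq_norm,
      normSq_cosh_half_sub]
    nlinarith [sq_nonneg (Real.sinh (β / 2))]
  have h2 : ‖Complex.exp (Complex.I * ω * (ρ * Real.cosh β : ℝ))‖
      ≤ Real.exp (-(ω.im * ρ / 2) * β ^ 2) := by
    rw [Complex.norm_exp, Complex.re_mul_ofReal]
    simp only [Complex.mul_re, Complex.I_re, zero_mul, Complex.I_im, one_mul, zero_sub]
    refine Real.exp_le_exp.2 ?_
    have := mul_le_mul_of_nonneg_left (one_add_half_sq_le_cosh β) (mul_pos hω hρ).le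
    nlinarith [mul_pos hω hρ]
  have := abs_pos.2 ha
  gcongr

/-- Changing `β` to `-β` conjugates `cosh ((β - ia)/2)`, so the sum of reciprocals is twice a real
part over a squared modulus. With `s = sinh (β/2)` and `c = cos (a/2)` one has `cosh β = 2(s² + c²)
- cos a`. The right side displays the Jacobian `ds/dβ` ready for the substitution. -/
theorem sechExp_add_neg {a : ℝ} (ha : Real.cos (a / 2) ≠ 0) (ω : ℂ) (ρ β : ℝ) :
    sechExp ω ρ a β + sechExp ω ρ a (-β)
      = 4 * Complex.exp (-Complex.I * ω * (ρ * Real.cos a : ℝ)) * (|Real.cosh (β / 2) * (1 / 2)| •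
        (((Real.cos (a / 2) / (Real.sinh (β / 2) ^ 2 + Real.cos (a / 2) ^ 2) : ℝ) : ℂ)
          * Complex.exp (-(-2 * Complex.I * ω * ρ)
            * ((Real.sinh (β / 2) ^ 2 + Real.cos (a / 2) ^ 2 : ℝ) : ℂ)))) := by
  have hne := cosh_half_sub_ne_zero ha β
  have hne' := cosh_half_sub_ne_zero ha (-β)
  have hq : Complex.cosh ((β - Complex.I * a) / 2) * Complex.cosh (((-β : ℝ) - Complex.I * a) / 2)
      = ((Real.sinh (β / 2) ^ 2 + Real.cos (a / 2) ^ 2 : ℝ) : ℂ) := by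
    rw [← normSq_cosh_half_sub, ← Complex.mul_conj, cosh_half_sub, cosh_half_sub, neg_div,
      Real.cosh_neg, Real.sinh_neg]
    congr 1
    simp only [map_sub, map_mul, Complex.conj_ofReal, Complex.conj_I]
    push_cast
    ring
  have hs : Complex.cosh ((β - Complex.I * a) / 2) + Complex.cosh (((-β : ℝ) - Complex.I * a) / 2)
      = ((2 * (Real.cosh (β / 2) * Real.cos (a / 2)) : ℝ) : ℂ) := by
    rw [cosh_half_sub, cosh_half_sub, neg_div, Real.cosh_neg, Real.sinh_neg]
    push_cast
    ring
  have hexp : Complex.exp (Complex.I * ω * (ρ * Real.cosh β : ℝ))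
      = Complex.exp (-Complex.I * ω * (ρ * Real.cos a : ℝ)) * Complex.exp (-(-2 * Complex.I * ω * ρ)
            * ((Real.sinh (β / 2) ^ 2 + Real.cos (a / 2) ^ 2 : ℝ) : ℂ)) := by
    rw [← Complex.exp_add]
    congr 1
    have h3 := Real.cosh_two_mul (β / 2)
    have h4 := Real.cosh_sq (β / 2)
    have h5 := Real.cos_two_mul (a / 2)
    rw [mul_div_cancel₀ _ two_ne_zero] at h3 h5
    have : Real.cosh β = 2 * Real.sinh (β / 2) ^ 2 + 1 := by rw [h3, h4]; ring
    rw [this, h5]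
    push_cast
    ring
  have hinv : (Complex.cosh ((β - Complex.I * a) / 2))⁻¹
      + (Complex.cosh (((-β : ℝ) - Complex.I * a) / 2))⁻¹
      = ((2 * (Real.cosh (β / 2) * Real.cos (a / 2)) : ℝ) : ℂ)
        / ((Real.sinh (β / 2) ^ 2 + Real.cos (a / 2) ^ 2 : ℝ) : ℂ) := by
    rw [← hs, ← hq]
    field_simp
    ring
  rw [sechExp, sechExp, Real.cosh_neg, ← add_mul, hinv, hexp,
    abs_of_pos (mul_pos (Real.cosh_pos _) one_half_pos), Complex.real_smul]
  push_cast
  ring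

theorem integral_sechExp {ω : ℂ} (hω : 0 < ω.im) {ρ : ℝ} (hρ : 0 < ρ) {a : ℝ}
    (ha : Real.cos (a / 2) ≠ 0) :
    ∫ β, sechExp ω ρ a β = 2 * Complex.exp (-Complex.I * ω * (ρ * Real.cos a : ℝ))
      * lorentzGauss (Real.cos (a / 2)) (-2 * Complex.I * ω * ρ) := by
  have hi := integrable_sechExp hω hρ ha
  have h1 : ∫ β, (sechExp ω ρ a β + sechExp ω ρ a (-β)) = 2 * ∫ β, sechExp ω ρ a β := by
    rw [integral_add hi hi.comp_neg, integral_neg_eq_self (sechExp ω ρ a), two_mul]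
  have hder : ∀ β ∈ (univ : Set ℝ),
      HasDerivWithinAt (fun β => Real.sinh (β / 2)) (Real.cosh (β / 2) * (1 / 2)) univ β :=
    fun β _ => ((Real.hasDerivAt_sinh _).comp β ((hasDerivAt_id β).div_const 2)).hasDerivWithinAt
  have hinj : InjOn (fun β => Real.sinh (β / 2)) univ := fun x _ y _ h => by
    have := Real.sinh_injective h
    linarith
  have hsurj : (fun β => Real.sinh (β / 2)) '' univ = univ := by
    rw [image_univ, range_eq_univ]
    intro y
    obtain ⟨x, rfl⟩ := Real.sinh_surjective y
    exact ⟨2 * x, by simp⟩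
  have h2 := integral_image_eq_integral_abs_deriv_smul MeasurableSet.univ hder hinj
    (fun s : ℝ => ((Real.cos (a / 2) / (s ^ 2 + Real.cos (a / 2) ^ 2) : ℝ) : ℂ)
          * Complex.exp (-(-2 * Complex.I * ω * ρ) * ((s ^ 2 + Real.cos (a / 2) ^ 2 : ℝ) : ℂ)))
  rw [hsurj, setIntegral_univ, setIntegral_univ] at h2
  simp_rw [sechExp_add_neg ha] at h1
  rw [integral_const_mul, ← h2] at h1
  rw [lorentzGauss]
  linear_combination (-1 / 2) * h1

/-- This oddness is the source of the jump of the diffracted field where `cos (a/2)` changes sign.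
-/
theorem lorentzGauss_neg (c : ℝ) (b : ℂ) : lorentzGauss (-c) b = -lorentzGauss c b := by
  rw [lorentzGauss, lorentzGauss, ← integral_neg]
  congr 1
  ext s
  rw [neg_sq, neg_div]
  push_cast
  ring

/-! ### Profiles and Fourier-Laplace transforms of delayed waves. -/

/-- The limit controls large `s` and the support controls `s < 0`. On the compact gap `[0, R]` the
weighted bound suffices for any sign of `p`. -/
theorem IsProfile.exists_norm_le {f : ℝ → ℂ} (hf : IsProfile f) : ∃ M, ∀ s, ‖f s‖ ≤ M := by
  obtain ⟨p, B, hB⟩ := hf.bounded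
  obtain ⟨R, hR⟩ := eventually_atTop.1
    (hf.tendsto_one.norm.eventually (gt_mem_nhds (show ‖(1 : ℂ)‖ < 2 by simp)))
  have hcont : ContinuousOn (fun s : ℝ => B * (1 + |s|) ^ (-p)) (Icc 0 R) := by
    refine continuousOn_const.mul (ContinuousOn.rpow_const (by fun_prop) fun s _ => Or.inl ?_)
    positivity
  obtain ⟨A, hA⟩ := isCompact_Icc.exists_bound_of_continuousOn hcont
  refine ⟨max 2 A, fun s => ?_⟩
  rcases lt_or_ge s 0 with h0 | h0
  · rw [hf.eq_zero_of_neg s h0, norm_zero]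
    exact le_max_of_le_left zero_le_two
  rcases le_or_gt R s with h1 | h1
  · exact (hR s h1).le.trans (le_max_left _ _)
  · refine le_max_of_le_right (le_trans ?_ ((le_abs_self _).trans (hA s ⟨h0, h1.le⟩)))
    have hb : (1 + |s|) ^ p * ‖f s‖ ≤ B := hB (mem_range_self s)
    have hpos : (0 : ℝ) < 1 + |s| := by positivity
    rw [Real.rpow_neg hpos.le, ← div_eq_mul_inv, le_div_iff₀ (Real.rpow_pos_of_pos hpos p), mul_comm]
    exact hb

theorem modulated_of_neg {f : ℝ → ℂ} (hf : IsProfile f) (ω₀ : ℝ) {s : ℝ} (hs : s < 0) :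
    modulated ω₀ f s = 0 := by
  rw [modulated, hf.eq_zero_of_neg s hs, zero_mul]

theorem integrable_exp_mul_modulated {f : ℝ → ℂ} (hf : IsProfile f) (ω₀ : ℝ) {ω : ℂ}
    (hω : 0 < ω.im) :
    Integrable fun s : ℝ => Complex.exp (Complex.I * ω * s) * modulated ω₀ f s := by
  obtain ⟨M, hM⟩ := hf.exists_norm_le
  have hmeas : AEStronglyMeasurable
      (fun s : ℝ => Complex.exp (Complex.I * ω * s) * modulated ω₀ f s) volume := by
    have h1 : Continuous fun s : ℝ => Complex.exp (Complex.I * ω * s) := by fun_prop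
    have h2 : Continuous fun s : ℝ => Complex.exp (-Complex.I * ω₀ * s) := by fun_prop
    exact h1.aestronglyMeasurable.mul
      (hf.locallyIntegrable.aestronglyMeasurable.mul h2.aestronglyMeasurable)
  rw [← integrableOn_iff_integrable_of_support_subset (s := Ici 0)]
  · rw [integrableOn_Ici_iff_integrableOn_Ioi]
    refine ((integrableOn_exp_mul_Ioi (neg_lt_zero.2 hω) 0).const_mul M).mono' hmeas.restrict
      (Eventually.of_forall fun s => ?_)
    have e1 : ‖Complex.exp (Complex.I * ω * s)‖ = Real.exp (-ω.im * s) := by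
      rw [Complex.norm_exp, Complex.re_mul_ofReal]
      simp
    have e2 : ‖Complex.exp (-Complex.I * ω₀ * s)‖ = 1 := by
      rw [Complex.norm_exp, Complex.re_mul_ofReal]
      simp
    rw [modulated, norm_mul, norm_mul, e1, e2, mul_one, mul_comm]
    gcongr
    exact hM s
  · intro s hs
    by_contra h
    exact hs (by simp [modulated_of_neg hf ω₀ (not_le.1 h)])

/-- The transform of the modulated profile. -/
def profileHat (ω₀ : ℝ) (f : ℝ → ℂ) (ω : ℂ) : ℂ :=
  ∫ s : ℝ, Complex.exp (Complex.I * ω * s) * modulated ω₀ f s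

theorem exp_mul_comp_sub (g : ℝ → ℂ) (ω : ℂ) (τ t : ℝ) :
    Complex.exp (Complex.I * ω * t) * g (t - τ) = Complex.exp (Complex.I * ω * τ) *
      (Complex.exp (Complex.I * ω * (t - τ : ℝ)) * g (t - τ)) := by
  rw [← mul_assoc, ← Complex.exp_add]
  congr 2
  push_cast
  ring

/-- This lets the integral over `t > 0` be replaced by one over the whole line, where translation
invariance applies. -/
theorem support_exp_mul_modulated_sub {f : ℝ → ℂ} (hf : IsProfile f) (ω₀ : ℝ) (ω : ℂ) {τ : ℝ}
    (hτ : 0 < τ) {t : ℝ} (ht : t ∉ Ioi 0) :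
    Complex.exp (Complex.I * ω * t) * modulated ω₀ f (t - τ) = 0 := by
  rw [mem_Ioi, not_lt] at ht
  rw [modulated_of_neg hf ω₀ (by linarith), mul_zero]

theorem fourierLaplace_shift {f : ℝ → ℂ} (hf : IsProfile f) (ω₀ : ℝ) {ω : ℂ} (hω : 0 < ω.im)
    {τ : ℝ} (hτ : 0 < τ) :
    FourierLaplaceConverges (fun t => modulated ω₀ f (t - τ)) ω ∧
      fourierLaplace (fun t => modulated ω₀ f (t - τ)) ω
        = profileHat ω₀ f ω * Complex.exp (Complex.I * ω * τ) := by
  have hz := fun t ht => support_exp_mul_modulated_sub hf ω₀ ω hτ (t := t) ht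
  constructor
  · refine Integrable.integrableOn ?_
    simp_rw [exp_mul_comp_sub (modulated ω₀ f)]
    exact ((integrable_exp_mul_modulated hf ω₀ hω).comp_sub_right τ).const_mul _
  · rw [fourierLaplace, setIntegral_eq_integral_of_forall_compl_eq_zero hz]
    simp_rw [exp_mul_comp_sub (modulated ω₀ f)]
    rw [integral_const_mul, integral_sub_right_eq_self
      (fun s : ℝ => Complex.exp (Complex.I * ω * s) * modulated ω₀ f s) τ, profileHat, mul_comm]

theorem fourierLaplace_superposition {f : ℝ → ℂ} (hf : IsProfile f) (ω₀ : ℝ) {ω : ℂ}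
    (hω : 0 < ω.im) {τ : ℝ → ℝ} (hτ : ∀ β, 0 < τ β) (hτc : Continuous τ) {k : ℝ → ℂ}
    (hk : Integrable fun β => k β * Complex.exp (Complex.I * ω * τ β)) :
    FourierLaplaceConverges (fun t => ∫ β, k β * modulated ω₀ f (t - τ β)) ω ∧
      fourierLaplace (fun t => ∫ β, k β * modulated ω₀ f (t - τ β)) ω
        = profileHat ω₀ f ω * ∫ β, k β * Complex.exp (Complex.I * ω * τ β) := by
  -- The shear `(β, t) ↦ (β, t - τ β)` preserves measure and turns the double integrand into a
  -- product, which justifies Fubini.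
  have hmp : MeasurePreserving (fun p : ℝ × ℝ => (p.1, p.2 - τ p.1)) (volume.prod volume)
      (volume.prod volume) :=
    (MeasurePreserving.id (volume : Measure ℝ)).skew_product (g := fun β t => t - τ β)
      (by unfold Function.uncurry; fun_prop)
      (Eventually.of_forall fun β => (measurePreserving_sub_right volume (τ β)).map_eq)
  have hprod := (hmp.integrable_comp_of_integrable
    (hk.mul_prod (integrable_exp_mul_modulated hf ω₀ hω)))
  have hint : Integrable (fun p : ℝ × ℝ =>
      Complex.exp (Complex.I * ω * p.2) * (k p.1 * modulated ω₀ f (p.2 - τ p.1)))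
      (volume.prod volume) := by
    refine hprod.congr (Eventually.of_forall fun p => ?_)
    simp only [Function.comp_apply]
    rw [mul_left_comm (Complex.exp (Complex.I * ω * p.2)), exp_mul_comp_sub (modulated ω₀ f)]
    ring
  have hmul : ∀ t : ℝ, Complex.exp (Complex.I * ω * t) * ∫ β, k β * modulated ω₀ f (t - τ β)
      = ∫ β, Complex.exp (Complex.I * ω * t) * (k β * modulated ω₀ f (t - τ β)) :=
    fun t => (integral_const_mul _ _).symm
  constructor
  · refine Integrable.integrableOn ?_
    simp_rw [hmul]
    exact hint.integral_prod_right
  · rw [fourierLaplace, setIntegral_eq_integral_of_forall_compl_eq_zero]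
    · simp_rw [hmul]
      rw [← integral_integral_swap hint, ← integral_const_mul]
      congr 1
      ext β
      simp_rw [mul_left_comm _ (k β), integral_const_mul]
      simp_rw [exp_mul_comp_sub (modulated ω₀ f)]
      rw [integral_const_mul, integral_sub_right_eq_self
        (fun s : ℝ => Complex.exp (Complex.I * ω * s) * modulated ω₀ f s) (τ β), profileHat]
      ring
    · intro t ht
      rw [hmul]
      simp_rw [mul_left_comm _ (k _)]
      simp_rw [support_exp_mul_modulated_sub hf ω₀ ω (hτ _) ht]
      simp

/-! ### The square-root branch on the slit plane. -/

/-- The identification of the plane with `ℂ`. -/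
def toC : Plane ≃ₗᵢ[ℝ] ℂ := Complex.orthonormalBasisOneI.repr.symm

theorem toC_apply (x : Plane) : toC x = x 0 + x 1 * Complex.I := by
  rw [toC, ← OrthonormalBasis.sum_repr_symm]
  simp [Fin.sum_univ_two]

theorem norm_toC (x : Plane) : ‖toC x‖ = ‖x‖ := toC.norm_map x

theorem neg_toC_mem_slitPlane {x : Plane} : -toC x ∈ Complex.slitPlane ↔ x ∈ Q := by
  rw [Complex.mem_slitPlane_iff, toC_apply, Q, mem_ofPred_eq, not_and_or, not_le, or_comm]
  simp

theorem isOpen_Q : IsOpen Q := by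
  have : Q = (fun x => -toC x) ⁻¹' Complex.slitPlane := by
    ext x
    exact neg_toC_mem_slitPlane.symm
  rw [this]
  exact Complex.isOpen_slitPlane.preimage toC.continuous.neg

theorem toC_ne_zero {x : Plane} (hx : x ∈ Q) : toC x ≠ 0 :=
  neg_ne_zero.1 (Complex.slitPlane_ne_zero (neg_toC_mem_slitPlane.2 hx))

theorem norm_pos_of_mem_Q {x : Plane} (hx : x ∈ Q) : 0 < ‖x‖ := by
  rw [← norm_toC]
  exact norm_pos_iff.2 (toC_ne_zero hx)

/-- The branch of `√(e^{-iθ} (x₁ + i x₂))` on `Q`, equal to `√ρ e^{i(φ-θ)/2}`. -/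
def branch (θ : ℝ) (x : Plane) : ℂ :=
  Complex.I * Complex.exp (-(Complex.I * θ) / 2) * Complex.exp (Complex.log (-toC x) / 2)

/-- Taking the logarithm of `-toC x` moves the cut onto the screen; the factor `Complex.I` in
`branch` compensates for the sign. -/
theorem branch_sq {x : Plane} (hx : x ∈ Q) (θ : ℝ) :
    branch θ x ^ 2 = Complex.exp (-(Complex.I * θ)) * toC x := by
  rw [branch, mul_pow, mul_pow, Complex.I_sq, ← Complex.exp_nat_mul, ← Complex.exp_nat_mul]
  push_cast
  rw [mul_div_cancel₀ _ two_ne_zero, mul_div_cancel₀ _ two_ne_zero,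
    Complex.exp_log (neg_ne_zero.2 (toC_ne_zero hx))]
  ring

theorem branch_ne_zero (θ : ℝ) (x : Plane) : branch θ x ≠ 0 := by
  simp [branch, Complex.exp_ne_zero]

theorem norm_exp_neg_I_mul (θ : ℝ) : ‖Complex.exp (-(Complex.I * θ))‖ = 1 := by
  rw [Complex.norm_exp]
  simp

theorem norm_branch_sq {x : Plane} (hx : x ∈ Q) (θ : ℝ) : ‖branch θ x‖ ^ 2 = ‖x‖ := by
  rw [← norm_pow, branch_sq hx, norm_mul, norm_exp_neg_I_mul, one_mul, norm_toC]

theorem contDiffAt_branch {x : Plane} (hx : x ∈ Q) (θ : ℝ) {n : WithTop ℕ∞} :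
    ContDiffAt ℝ n (branch θ) x := by
  have h1 : ContDiffAt ℝ n (fun y => -toC y) x := toC.contDiff.neg.contDiffAt
  have hl : ContDiffAt ℝ n Complex.log (-toC x) :=
    (Complex.contDiffAt_log (neg_toC_mem_slitPlane.2 hx)).restrict_scalars ℝ
  have h2 : ContDiffAt ℝ n (fun y => Complex.log (-toC y)) x :=
    ContDiffAt.comp (g := Complex.log) (f := fun y => -toC y) x hl h1
  exact contDiffAt_const.mul (h2.div_const 2).cexp

theorem hasDerivAt_toC_line (x e : Plane) (t : ℝ) :
    HasDerivAt (fun t : ℝ => toC (x + t • e)) (toC e) t := by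
  have h : HasDerivAt (fun t : ℝ => x + t • e) e t := by
    simpa using ((hasDerivAt_id t).smul_const e).const_add x
  exact toC.toContinuousLinearEquiv.toContinuousLinearMap.hasFDerivAt.comp_hasDerivAt t h

theorem hasDerivAt_branch_line {x : Plane} (hx : x ∈ Q) (θ : ℝ) (e : Plane) :
    HasDerivAt (fun t : ℝ => branch θ (x + t • e))
      (Complex.exp (-(Complex.I * θ)) * toC e / (2 * branch θ x)) 0 := by
  have h1 : HasDerivAt (fun t : ℝ => -toC (x + t • e)) (-toC e) 0 := (hasDerivAt_toC_line x e 0).neg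
  have h2 := ((h1.clog_real (by simpa using neg_toC_mem_slitPlane.2 hx)).div_const 2).cexp.const_mul
    (Complex.I * Complex.exp (-(Complex.I * θ) / 2))
  refine h2.congr_deriv ?_
  have hX := toC_ne_zero hx
  have hS := branch_ne_zero θ x
  simp only [zero_smul, add_zero]
  rw [← mul_assoc, eq_div_iff (by simpa using hS)]
  change branch θ x * (-toC e / -toC x / 2) * (2 * branch θ x) = _
  have : branch θ x * (-toC e / -toC x / 2) * (2 * branch θ x)
      = branch θ x ^ 2 * (toC e / toC x) := by
    rw [neg_div_neg_eq]; ring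
  rw [this, branch_sq hx]
  field_simp

/-! ### Edge waves and the Helmholtz equation. -/

/-- The wave `e^{-iω ℓ} erfc (κ √ρ cos ((φ-θ)/2))`, where `ℓ = ρ cos (φ-θ)`. -/
def edgeWave (ω : ℂ) (θ : ℝ) (κ : ℂ) (x : Plane) : ℂ :=
  Complex.exp (-(Complex.I * ω) * ((Complex.exp (-(Complex.I * θ)) * toC x).re : ℝ))
    * cerfc (κ * ((branch θ x).re : ℝ))

theorem contDiffAt_edgeWave {x : Plane} (hx : x ∈ Q) (ω : ℂ) (θ : ℝ) (κ : ℂ) {n : WithTop ℕ∞} :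
    ContDiffAt ℝ n (edgeWave ω θ κ) x := by
  have hre : ∀ {g : Plane → ℂ}, ContDiffAt ℝ n g x →
      ContDiffAt ℝ n (fun y => (((g y).re : ℝ) : ℂ)) x := fun hg =>
    Complex.ofRealCLM.contDiff.contDiffAt.comp x (Complex.reCLM.contDiff.contDiffAt.comp x hg)
  have h1 : ContDiffAt ℝ n (fun y => Complex.exp (-(Complex.I * θ)) * toC y) x :=
    contDiffAt_const.mul toC.contDiff.contDiffAt
  exact (contDiffAt_const.mul (hre h1)).cexp.mul
    ((contDiff_cerfc.restrict_scalars ℝ).contDiffAt.comp x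
      (contDiffAt_const.mul (hre (contDiffAt_branch hx θ))))

/-- The derivative of `edgeWave ω θ κ` at `x` in the direction `e`. -/
def edgeWaveDeriv (ω : ℂ) (θ : ℝ) (κ : ℂ) (e x : Plane) : ℂ :=
  -(Complex.I * ω) * ((Complex.exp (-(Complex.I * θ)) * toC e).re : ℝ) * edgeWave ω θ κ x
    - (2 / √Real.pi : ℝ) * κ
      * Complex.exp (Complex.I * ω * ((branch θ x).re ^ 2 + (branch θ x).im ^ 2 : ℝ))
      * ((Complex.exp (-(Complex.I * θ)) * toC e / (2 * branch θ x)).re : ℝ)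

theorem hasDerivAt_re {g : ℝ → ℂ} {g' : ℂ} {t : ℝ} (h : HasDerivAt g g' t) :
    HasDerivAt (fun t => (g t).re) g'.re t :=
  Complex.reCLM.hasFDerivAt.comp_hasDerivAt t h

theorem hasDerivAt_im {g : ℝ → ℂ} {g' : ℂ} {t : ℝ} (h : HasDerivAt g g' t) :
    HasDerivAt (fun t => (g t).im) g'.im t :=
  Complex.imCLM.hasFDerivAt.comp_hasDerivAt t h

theorem re_branch_sq {x : Plane} (hx : x ∈ Q) (θ : ℝ) :
    (Complex.exp (-(Complex.I * θ)) * toC x).re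
      = (branch θ x).re ^ 2 - (branch θ x).im ^ 2 := by
  rw [← branch_sq hx, sq, Complex.mul_re]
  ring

theorem hasDerivAt_edgeWave_line {x : Plane} (hx : x ∈ Q) {ω κ : ℂ} (hκ : κ ^ 2 = -2 * Complex.I * ω)
    (θ : ℝ) (e : Plane) :
    HasDerivAt (fun t : ℝ => edgeWave ω θ κ (x + t • e)) (edgeWaveDeriv ω θ κ e x) 0 := by
  have h1 := (hasDerivAt_re
    ((hasDerivAt_toC_line x e 0).const_mul (Complex.exp (-(Complex.I * θ))))).ofReal_comp.const_mul
    (-(Complex.I * ω))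
  have h2 := (hasDerivAt_re (hasDerivAt_branch_line hx θ e)).ofReal_comp.const_mul κ
  have h3 := h1.cexp.mul ((hasDerivAt_cerfc _).comp 0 h2)
  refine h3.congr_deriv ?_
  simp only [zero_smul, add_zero, Function.comp_apply]
  -- With `ℓ = (Re S)² - (Im S)²` and `κ² = -2iω`, the plane wave times the Gaussian is the circular
  -- wave `e^{iω|S|²} = e^{iωρ}`.
  have hexp : Complex.exp (-(Complex.I * ω) * ((Complex.exp (-(Complex.I * θ)) * toC x).re : ℝ))
      * Complex.exp (-(κ * ((branch θ x).re : ℝ)) ^ 2)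
      = Complex.exp (Complex.I * ω * ((branch θ x).re ^ 2 + (branch θ x).im ^ 2 : ℝ)) := by
    rw [← Complex.exp_add, re_branch_sq hx]
    congr 1
    push_cast
    linear_combination (-((branch θ x).re : ℂ) ^ 2) * hκ
  rw [edgeWaveDeriv, edgeWave, ← hexp]
  ring

theorem fderiv_apply_of_hasDerivAt_line {g : Plane → ℂ} {x e : Plane} {d : ℂ}
    (hg : DifferentiableAt ℝ g x) (h : HasDerivAt (fun t : ℝ => g (x + t • e)) d 0) :
    fderiv ℝ g x e = d := by
  have := hg.hasFDerivAt.hasLineDerivAt e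
  exact HasDerivAt.unique this h

theorem fderiv_edgeWave {x : Plane} (hx : x ∈ Q) {ω κ : ℂ} (hκ : κ ^ 2 = -2 * Complex.I * ω)
    (θ : ℝ) (e : Plane) : fderiv ℝ (edgeWave ω θ κ) x e = edgeWaveDeriv ω θ κ e x :=
  fderiv_apply_of_hasDerivAt_line
    ((contDiffAt_edgeWave hx ω θ κ (n := 1)).differentiableAt one_ne_zero)
    (hasDerivAt_edgeWave_line hx hκ θ e)

theorem hasDerivAt_edgeWaveDeriv_line {x : Plane} (hx : x ∈ Q) {ω κ : ℂ}
    (hκ : κ ^ 2 = -2 * Complex.I * ω) (θ : ℝ) (e : Plane) {D : ℂ}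
    (hD : D = Complex.exp (-(Complex.I * θ)) * toC e / (2 * branch θ x)) :
    HasDerivAt (fun t : ℝ => edgeWaveDeriv ω θ κ e (x + t • e))
      (-(Complex.I * ω) * ((Complex.exp (-(Complex.I * θ)) * toC e).re : ℝ)
          * edgeWaveDeriv ω θ κ e x
        - (2 / √Real.pi : ℝ) * κ
          * Complex.exp (Complex.I * ω * ((branch θ x).re ^ 2 + (branch θ x).im ^ 2 : ℝ))
          * (Complex.I * ω * (2 * ((branch θ x).re * D.re + (branch θ x).im * D.im) * D.re : ℝ)
            + ((-D ^ 2 / branch θ x).re : ℝ))) 0 := by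
  have hb := hasDerivAt_branch_line hx θ e
  rw [← hD] at hb
  have h1 := (hasDerivAt_edgeWave_line hx hκ θ e).const_mul
    (-(Complex.I * ω) * ((Complex.exp (-(Complex.I * θ)) * toC e).re : ℝ))
  have h2 := (((hasDerivAt_re hb).pow 2).add
    ((hasDerivAt_im hb).pow 2)).ofReal_comp.const_mul (Complex.I * ω)
  have hne : (2 * branch θ (x + (0 : ℝ) • e)) ≠ 0 := by simpa using branch_ne_zero θ _
  have h3 := (hasDerivAt_re ((hasDerivAt_const (0 : ℝ)
    (Complex.exp (-(Complex.I * θ)) * toC e)).div (hb.const_mul 2) hne)).ofReal_comp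
  have h4 := h1.sub ((h2.cexp.const_mul ((2 / √Real.pi : ℝ) * κ)).mul h3)
  refine h4.congr_deriv ?_
  simp only [zero_smul, add_zero, Pi.add_apply, Pi.pow_apply, Pi.div_apply]
  rw [← hD]
  have e1 : (0 * (2 * branch θ x) - Complex.exp (-(Complex.I * θ)) * toC e * (2 * D))
      / (2 * branch θ x) ^ 2 = -D ^ 2 / branch θ x := by
    have : Complex.exp (-(Complex.I * θ)) * toC e = D * (2 * branch θ x) := by
      rw [hD, div_mul_cancel₀]
      simpa using branch_ne_zero θ x
    rw [this]
    have := branch_ne_zero θ x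
    field_simp
    ring
  rw [e1]
  push_cast
  ring

/-- In the sum of the two second derivatives all terms carrying `e^{iωρ}` cancel, since `S` is
holomorphic with derivative `A` and `e^{-iθ} = 2SA`. There remains `(iω)² |e^{-iθ}|²` times the
wave. -/
theorem laplacian_edgeWave {x : Plane} (hx : x ∈ Q) {ω κ : ℂ} (hκ : κ ^ 2 = -2 * Complex.I * ω)
    (θ : ℝ) : Laplacian.laplacian (edgeWave ω θ κ) x = -ω ^ 2 * edgeWave ω θ κ x := by
  have hsecond : ∀ e : Plane, ∀ d : ℂ,
      HasDerivAt (fun t : ℝ => edgeWaveDeriv ω θ κ e (x + t • e)) d 0 →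
      iteratedFDeriv ℝ 2 (edgeWave ω θ κ) x ![e, e] = d := by
    intro e d h
    rw [iteratedFDeriv_two_apply]
    have hdiff : DifferentiableAt ℝ (fderiv ℝ (edgeWave ω θ κ)) x :=
      ((contDiffAt_edgeWave hx ω θ κ (n := 2)).fderiv_right (m := 1) (by norm_num)).differentiableAt
        one_ne_zero
    have hl : HasDerivAt (fun t : ℝ => fderiv ℝ (edgeWave ω θ κ) (x + t • e) e)
        (fderiv ℝ (fderiv ℝ (edgeWave ω θ κ)) x e e) 0 :=
      (ContinuousLinearMap.apply ℝ ℂ e).hasFDerivAt.comp_hasDerivAt 0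
        (hdiff.hasFDerivAt.hasLineDerivAt e)
    refine hl.unique (h.congr_of_eventuallyEq ?_)
    have hcont : ContinuousAt (fun t : ℝ => x + t • e) 0 := by fun_prop
    have : ∀ᶠ t : ℝ in 𝓝 0, x + t • e ∈ Q :=
      hcont.eventually_mem (isOpen_Q.mem_nhds (by simpa using hx))
    filter_upwards [this] with t ht
    exact fderiv_edgeWave ht hκ θ e
  set S := branch θ x with hS
  have hS0 : S ≠ 0 := branch_ne_zero θ x
  obtain ⟨A, hA⟩ : ∃ A : ℂ, A = Complex.exp (-(Complex.I * θ)) / (2 * S) := ⟨_, rfl⟩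
  have hm : Complex.exp (-(Complex.I * θ)) = 2 * S * A := by
    rw [hA]; field_simp
  have h0 : toC (EuclideanSpace.basisFun (Fin 2) ℝ 0) = 1 := by
    simp [toC_apply]
  have h1 : toC (EuclideanSpace.basisFun (Fin 2) ℝ 1) = Complex.I := by
    simp [toC_apply]
  rw [InnerProductSpace.laplacian_eq_iteratedFDeriv_orthonormalBasis _
    (EuclideanSpace.basisFun (Fin 2) ℝ)]
  beta_reduce
  rw [Fin.sum_univ_two,
    hsecond _ _ (hasDerivAt_edgeWaveDeriv_line hx hκ θ _ (D := A) (by rw [h0, hA, mul_one])),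
    hsecond _ _ (hasDerivAt_edgeWaveDeriv_line hx hκ θ _ (D := A * Complex.I)
      (by rw [h1, hA]; ring)),
    edgeWaveDeriv, edgeWaveDeriv, h0, h1, ← hS]
  have hunit : (((2 * S * A).re : ℝ) : ℂ) ^ 2 + (((2 * S * A).im : ℝ) : ℂ) ^ 2 = 1 := by
    have := norm_exp_neg_I_mul θ
    rw [hm] at this
    have h2 := Complex.sq_norm (2 * S * A)
    rw [this, Complex.normSq_apply] at h2
    have h3 : (2 * S * A).re ^ 2 + (2 * S * A).im ^ 2 = 1 := by linarith
    exact_mod_cast h3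
  have hSm : 2 * S * A / (2 * S) = A := by field_simp
  have hSm' : 2 * S * A * Complex.I / (2 * S) = A * Complex.I := by field_simp
  -- The second derivatives of `S` along the two axes are opposite: its real part is harmonic.
  have hz : ((-(A * Complex.I) ^ 2 / S).re : ℝ) = -((-A ^ 2 / S).re : ℝ) := by
    rw [mul_pow, Complex.I_sq, ← Complex.neg_re]
    congr 1
    ring
  rw [hm, mul_one, hSm, hSm', hz]
  set EE := Complex.exp (Complex.I * ω * ((S.re ^ 2 + S.im ^ 2 : ℝ)))
  set W := edgeWave ω θ κ x
  set q := (-A ^ 2 / S).re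
  have r1 : ((2 * S * A * Complex.I).re : ℝ) = -(2 * S * A).im := by simp
  have r2 : (A * Complex.I).re = -A.im := by simp
  have r3 : (A * Complex.I).im = A.re := by simp
  have r4 : (2 * S * A).re = 2 * (S.re * A.re - S.im * A.im) := by
    simp [mul_assoc]
  have r5 : (2 * S * A).im = 2 * (S.re * A.im + S.im * A.re) := by
    simp [mul_assoc]
  rw [r1, r2, r3]
  rw [r4, r5] at hunit ⊢
  push_cast at hunit ⊢
  have hI := Complex.I_sq
  linear_combination (-ω ^ 2 * W) * hunit + (ω ^ 2 * W * ((2 * (S.re * A.re - S.im * A.im)) ^ 2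
    + (2 * (S.re * A.im + S.im * A.re)) ^ 2)) * hI

/-! ### Exponential bounds for edge waves. -/

/-- For `s = ε Re S ≥ 0` the exponents add up to `Im ω (ℓ - 2s²) = -Im ω ρ`. For `s < 0` the
reflection formula leaves an additional `2`, which multiplies a plane wave decaying by the second
alternative; hence the constant `3 = 2 + 1`. -/
theorem norm_edgeWave_le {x : Plane} (hx : x ∈ Q) {ω κ : ℂ} (hκ : κ ^ 2 = -2 * Complex.I * ω)
    (hκ₀ : 0 < κ.re) (hω : 0 < ω.im) (θ : ℝ) {ε c : ℝ} (hε : ε ^ 2 = 1) (hc : c ≤ 1)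
    (h : 0 ≤ ε * (branch θ x).re ∨ (Complex.exp (-(Complex.I * θ)) * toC x).re ≤ -c * ‖x‖) :
    ‖edgeWave ω θ (κ * ε) x‖ ≤ 3 * Real.exp (-(ω.im * c) * ‖x‖) := by
  have hκre : (κ ^ 2).re = 2 * ω.im := by rw [hκ]; simp
  have hκpos : 0 < (κ ^ 2).re := by rw [hκre]; positivity
  have hρ := norm_nonneg x
  have hnorm : (branch θ x).re ^ 2 + (branch θ x).im ^ 2 = ‖x‖ := by
    rw [← norm_branch_sq hx θ, Complex.sq_norm, Complex.normSq_apply]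
    ring
  have hℓ := re_branch_sq hx θ
  set ℓ := (Complex.exp (-(Complex.I * θ)) * toC x).re with hℓ_def
  set s := ε * (branch θ x).re with hs_def
  have hs2 : s ^ 2 = (branch θ x).re ^ 2 := by rw [hs_def, mul_pow, hε, one_mul]
  have hval : edgeWave ω θ (κ * ε) x = Complex.exp (-(Complex.I * ω) * (ℓ : ℝ)) * cerfc (κ * (s : ℝ)) := by
    rw [edgeWave, ← hℓ_def, hs_def]
    congr 2
    push_cast
    ring
  have hexp : ‖Complex.exp (-(Complex.I * ω) * (ℓ : ℝ))‖ = Real.exp (ω.im * ℓ) := by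
    rw [Complex.norm_exp, Complex.re_mul_ofReal]
    simp
  have hdecay : Real.exp (ω.im * ℓ) * Real.exp (-((κ ^ 2).re * s ^ 2))
      ≤ Real.exp (-(ω.im * c) * ‖x‖) := by
    rw [← Real.exp_add, hκre, hs2, hℓ]
    refine Real.exp_le_exp.2 ?_
    have h1 : ω.im * c * ‖x‖ ≤ ω.im * ‖x‖ := by
      refine mul_le_mul_of_nonneg_right ?_ hρ
      nlinarith
    have h2 : ω.im * ‖x‖ = ω.im * ((branch θ x).re ^ 2 + (branch θ x).im ^ 2) := by rw [hnorm]
    linarith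
  have hpos := (Real.exp_pos (-(ω.im * c) * ‖x‖)).le
  rw [hval, norm_mul, hexp]
  rcases le_or_gt 0 s with hs | hs
  · have := mul_le_mul_of_nonneg_left (norm_cerfc_le hκ₀ hκpos hs) (Real.exp_pos (ω.im * ℓ)).le
    linarith
  · have hl := h.resolve_left hs.not_ge
    have h1 := norm_cerfc_le hκ₀ hκpos (neg_nonneg.2 hs.le)
    have h2 : cerfc (κ * (s : ℝ)) = 2 - cerfc (κ * ((-s : ℝ) : ℂ)) := by
      rw [← cerfc_neg]
      congr 1
      push_cast
      ring
    have h3 : ‖cerfc (κ * (s : ℝ))‖ ≤ 2 + Real.exp (-((κ ^ 2).re * s ^ 2)) := by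
      rw [h2]
      refine (norm_sub_le _ _).trans ?_
      rw [neg_sq] at h1
      simpa using h1
    have h4 : Real.exp (ω.im * ℓ) ≤ Real.exp (-(ω.im * c) * ‖x‖) := by
      refine Real.exp_le_exp.2 ?_
      have := mul_le_mul_of_nonneg_left hl hω.le
      linarith
    have h5 := mul_le_mul_of_nonneg_left h3 (Real.exp_pos (ω.im * ℓ)).le
    linarith

/-- The plane-wave factor contributes `|ω|` times the wave. The error function contributes `e^{iωρ}`
over `2S`, with `|S| = √ρ`. -/
theorem norm_fderiv_edgeWave_le {x : Plane} (hx : x ∈ Q) {ω κ : ℂ}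
    (hκ : κ ^ 2 = -2 * Complex.I * ω) (θ : ℝ) {B : ℝ} (hB : ‖edgeWave ω θ κ x‖ ≤ B)
    (hB' : Real.exp (-ω.im * ‖x‖) ≤ B) (e : Plane) :
    ‖fderiv ℝ (edgeWave ω θ κ) x e‖
      ≤ (‖ω‖ + 2 / √Real.pi * ‖κ‖) * B * ‖e‖ * (1 + ‖x‖ ^ (-(1 / 2) : ℝ)) := by
  have hρ := norm_pos_of_mem_Q hx
  have hnorm : (branch θ x).re ^ 2 + (branch θ x).im ^ 2 = ‖x‖ := by
    rw [← norm_branch_sq hx θ, Complex.sq_norm, Complex.normSq_apply]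
    ring
  have hbr : ‖branch θ x‖ = ‖x‖ ^ (1 / 2 : ℝ) := by
    rw [← Real.sqrt_eq_rpow, ← norm_branch_sq hx θ, Real.sqrt_sq (norm_nonneg _)]
  have hr := Real.rpow_pos_of_pos hρ (-(1 / 2) : ℝ)
  have hB0 : 0 ≤ B := (norm_nonneg _).trans hB
  have h1 : |(Complex.exp (-(Complex.I * θ)) * toC e).re| ≤ ‖e‖ := by
    refine (Complex.abs_re_le_norm _).trans_eq ?_
    rw [norm_mul, norm_exp_neg_I_mul, one_mul, norm_toC]
  have h2 : |(Complex.exp (-(Complex.I * θ)) * toC e / (2 * branch θ x)).re|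
      ≤ ‖e‖ * ‖x‖ ^ (-(1 / 2) : ℝ) := by
    refine (Complex.abs_re_le_norm _).trans ?_
    rw [norm_div, norm_mul, norm_mul, norm_exp_neg_I_mul, one_mul, norm_toC, hbr,
      Real.rpow_neg hρ.le, Complex.norm_ofNat, ← div_eq_mul_inv]
    have := Real.rpow_pos_of_pos hρ (1 / 2 : ℝ)
    gcongr
    linarith
  have h3 : ‖Complex.exp (Complex.I * ω * ((branch θ x).re ^ 2 + (branch θ x).im ^ 2 : ℝ))‖ ≤ B := by
    rw [hnorm, Complex.norm_exp, Complex.re_mul_ofReal]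
    simpa using hB'
  have hp : 0 ≤ 2 / √Real.pi := by positivity
  rw [fderiv_edgeWave hx hκ, edgeWaveDeriv]
  refine (norm_sub_le _ _).trans ?_
  rw [norm_mul, norm_mul, norm_mul, norm_mul, norm_mul, norm_neg, norm_mul, Complex.norm_I, one_mul,
    Complex.norm_real, Complex.norm_real, Complex.norm_real, Real.norm_of_nonneg hp,
    Real.norm_eq_abs, Real.norm_eq_abs]
  calc _ ≤ ‖ω‖ * ‖e‖ * B + 2 / √Real.pi * ‖κ‖ * B * (‖e‖ * ‖x‖ ^ (-(1 / 2) : ℝ)) := by gcongr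
    _ ≤ ‖ω‖ * ‖e‖ * B + 2 / √Real.pi * ‖κ‖ * B * (‖e‖ * ‖x‖ ^ (-(1 / 2) : ℝ))
        + (‖ω‖ * ‖e‖ * B * ‖x‖ ^ (-(1 / 2) : ℝ) + 2 / √Real.pi * ‖κ‖ * B * ‖e‖) :=
      le_add_of_nonneg_right (by positivity)
    _ = _ := by ring

/-! ### The edge waves in polar coordinates. -/

theorem toC_polarPt (ρ φ : ℝ) : toC (polarPt ρ φ) = ρ * Complex.exp (Complex.I * φ) := by
  rw [toC_apply, mul_comm Complex.I, Complex.exp_mul_I]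
  simp [polarPt]
  ring

theorem branch_polarPt {ρ φ : ℝ} (hρ : 0 < ρ) (h0 : 0 < φ) (h1 : φ < 2 * Real.pi) (θ : ℝ) :
    branch θ (polarPt ρ φ) = (√ρ : ℝ) * Complex.exp (((φ - θ) / 2 : ℝ) * Complex.I) := by
  have hlog : -toC (polarPt ρ φ)
      = Complex.exp ((Real.log ρ : ℝ) + ((φ - Real.pi : ℝ) : ℂ) * Complex.I) := by
    rw [toC_polarPt, Complex.exp_add, ← Complex.ofReal_exp, Real.exp_log hρ]
    push_cast
    rw [sub_mul, Complex.exp_sub, Complex.exp_pi_mul_I, mul_comm Complex.I]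
    ring
  have hsqrt : ((√ρ : ℝ) : ℂ) = Complex.exp ((Real.log ρ / 2 : ℝ)) := by
    rw [← Complex.ofReal_exp, Real.exp_half, Real.exp_log hρ]
  have hI : Complex.I = Complex.exp (Real.pi / 2 * Complex.I) := Complex.exp_pi_div_two_mul_I.symm
  rw [branch, hlog, Complex.log_exp (by simp; linarith) (by simp; linarith), hsqrt]
  nth_rewrite 1 [hI]
  rw [← Complex.exp_add, ← Complex.exp_add, ← Complex.exp_add]
  congr 1
  push_cast
  ring

theorem re_branch_polarPt {ρ φ : ℝ} (hρ : 0 < ρ) (h0 : 0 < φ) (h1 : φ < 2 * Real.pi) (θ : ℝ) :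
    (branch θ (polarPt ρ φ)).re = √ρ * Real.cos ((φ - θ) / 2) := by
  rw [branch_polarPt hρ h0 h1, Complex.re_ofReal_mul, Complex.exp_ofReal_mul_I_re]

theorem re_exp_mul_toC_polarPt (ρ φ θ : ℝ) :
    (Complex.exp (-(Complex.I * θ)) * toC (polarPt ρ φ)).re = ρ * Real.cos (φ - θ) := by
  have : Complex.exp (-(Complex.I * θ)) * toC (polarPt ρ φ)
      = (ρ : ℝ) * Complex.exp ((φ - θ : ℝ) * Complex.I) := by
    rw [toC_polarPt, mul_left_comm, ← Complex.exp_add]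
    congr 2
    push_cast
    ring
  rw [this, Complex.re_ofReal_mul, Complex.exp_ofReal_mul_I_re]

theorem exists_polarPt_of_mem_Q {x : Plane} (hx : x ∈ Q) :
    ∃ ρ φ : ℝ, 0 < ρ ∧ 0 < φ ∧ φ < 2 * Real.pi ∧ x = polarPt ρ φ := by
  have hmem := neg_toC_mem_slitPlane.2 hx
  refine ⟨‖x‖, Complex.arg (-toC x) + Real.pi, norm_pos_of_mem_Q hx, ?_, ?_, ?_⟩
  · linarith [Complex.neg_pi_lt_arg (-toC x)]
  · have := lt_of_le_of_ne (Complex.arg_le_pi (-toC x)) (Complex.mem_slitPlane_iff_arg.1 hmem).1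
    linarith
  · apply toC.injective
    rw [toC_polarPt]
    have := Complex.norm_mul_exp_arg_mul_I (-toC x)
    rw [norm_neg, norm_toC] at this
    push_cast
    rw [mul_add, Complex.exp_add, mul_comm Complex.I, mul_comm Complex.I, Complex.exp_pi_mul_I,
      ← mul_assoc, this]
    ring

/-! ### The transform of the scattered wave. -/

/-- `h` has the absolutely convergent Fourier-Laplace transform `L` at `ω`. -/
def HasFourierLaplace (h : ℝ → ℂ) (ω L : ℂ) : Prop :=
  FourierLaplaceConverges h ω ∧ fourierLaplace h ω = L

theorem HasFourierLaplace.add {g h : ℝ → ℂ} {ω L M : ℂ} (hg : HasFourierLaplace g ω L)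
    (hh : HasFourierLaplace h ω M) : HasFourierLaplace (fun t => g t + h t) ω (L + M) := by
  constructor
  · unfold FourierLaplaceConverges
    simp_rw [mul_add]
    exact Integrable.add hg.1 hh.1
  · unfold fourierLaplace
    simp_rw [mul_add]
    rw [integral_add hg.1 hh.1, ← hg.2, ← hh.2]
    rfl

theorem HasFourierLaplace.const_mul {h : ℝ → ℂ} {ω L : ℂ} (hh : HasFourierLaplace h ω L) (a : ℂ) :
    HasFourierLaplace (fun t => a * h t) ω (a * L) := by
  constructor
  · unfold FourierLaplaceConverges
    simp_rw [mul_left_comm _ a]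
    exact Integrable.const_mul hh.1 a
  · unfold fourierLaplace
    simp_rw [mul_left_comm _ a]
    rw [integral_const_mul, ← hh.2]
    rfl

theorem hasFourierLaplace_zero (ω : ℂ) : HasFourierLaplace (fun _ => 0) ω 0 := by
  constructor
  · simp [FourierLaplaceConverges]
  · simp [fourierLaplace]

theorem lorentzGauss_eq_of_ne_zero {c : ℝ} (hc : c ≠ 0) {κ : ℂ} (hκ : 0 < κ.re)
    (hκ2 : 0 < (κ ^ 2).re) {r : ℝ} (hr : 0 ≤ r) :
    lorentzGauss c (κ ^ 2 * r)
      = Real.pi * (cerfc (κ * (√r * c : ℝ)) - if c < 0 then 2 else 0) := by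
  rcases hc.lt_or_gt with h | h
  · rw [if_pos h, ← neg_neg c, lorentzGauss_neg, lorentzGauss_eq_cerfc (neg_pos.2 h) hκ hκ2 hr]
    have : κ * ((√r * - -c : ℝ) : ℂ) = -(κ * (√r : ℝ) * (-c : ℝ)) := by push_cast; ring
    rw [this, cerfc_neg]
    ring
  · rw [if_neg h.not_gt, sub_zero, lorentzGauss_eq_cerfc h hκ hκ2 hr]
    push_cast
    rw [mul_assoc]

theorem cos_half_sub_pos {α φ : ℝ} (hα₂ : α < Real.pi) (h0 : 0 < φ)
    (h : φ < phiPlus α) : 0 < Real.cos ((φ - α) / 2) := by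
  rw [phiPlus] at h
  exact Real.cos_pos_of_mem_Ioo ⟨by linarith, by linarith⟩

theorem cos_half_sub_neg {α φ : ℝ} (hα₁ : Real.pi / 2 < α) (h1 : φ < 2 * Real.pi)
    (h : phiPlus α < φ) : Real.cos ((φ - α) / 2) < 0 := by
  rw [phiPlus] at h
  exact Real.cos_neg_of_pi_div_two_lt_of_lt (by linarith) (by linarith)

theorem cos_half_add_pos {α φ : ℝ} (hα₁ : Real.pi / 2 < α) (h0 : 0 < φ)
    (h : φ < phiMinus α) : 0 < Real.cos ((φ + α) / 2) := by
  rw [phiMinus] at h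
  exact Real.cos_pos_of_mem_Ioo ⟨by linarith, by linarith⟩

theorem cos_half_add_neg {α φ : ℝ} (hα₂ : α < Real.pi) (h1 : φ < 2 * Real.pi)
    (h : phiMinus α < φ) : Real.cos ((φ + α) / 2) < 0 := by
  rw [phiMinus] at h
  exact Real.cos_neg_of_pi_div_two_lt_of_lt (by linarith) (by linarith)

/-- Here `2π - (φ - α)` lies in `(α, π]`, where cosine is decreasing. As `cos α < 0`, this makes the
delay of the incident wave positive and its transform decaying in this sector. -/
theorem cos_sub_le {α φ : ℝ} (hα₁ : Real.pi / 2 < α) (hα₂ : α < Real.pi) (h1 : φ < 2 * Real.pi)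
    (h : phiPlus α ≤ φ) : Real.cos (φ - α) ≤ Real.cos α := by
  rw [phiPlus] at h
  rw [← Real.cos_two_pi_sub]
  exact Real.cos_le_cos_of_nonneg_of_le_pi (by linarith) (by linarith) (by linarith)

theorem cos_add_le {α φ : ℝ} (hα₁ : Real.pi / 2 < α) (hα₂ : α < Real.pi) (h0 : 0 < φ)
    (h : φ ≤ phiMinus α) : Real.cos (φ + α) ≤ Real.cos α := by
  rw [phiMinus] at h
  exact Real.cos_le_cos_of_nonneg_of_le_pi (by linarith) (by linarith) (by linarith)

theorem inner_dirInc_polarPt (α ρ φ : ℝ) :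
    inner ℝ (dirInc α) (polarPt ρ φ) = -(ρ * Real.cos (φ - α)) := by
  rw [PiLp.inner_apply, Fin.sum_univ_two]
  simp [dirInc, polarPt, Real.cos_add, Real.sin_add, Real.cos_sub]
  ring

theorem inner_dirRefl_polarPt (α ρ φ : ℝ) :
    inner ℝ (dirRefl α) (polarPt ρ φ) = -(ρ * Real.cos (φ + α)) := by
  rw [PiLp.inner_apply, Fin.sum_univ_two]
  simp [dirRefl, polarPt, Real.cos_add, Real.sin_add]
  ring

/-- The prefactor is `(i/8π) · 2i = -1/(4π)`; the cosine conditions keep the poles of the kernel off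
the real `β`-axis. -/
theorem hasFourierLaplace_uDiffr {α : ℝ} (ω₀ : ℝ) {f : ℝ → ℂ} (hf : IsProfile f) {ω : ℂ}
    (hω : 0 < ω.im) {ρ φ : ℝ} (hρ : 0 < ρ) (hm : Real.cos ((φ - α) / 2) ≠ 0)
    (hp : Real.cos ((φ + α) / 2) ≠ 0) :
    HasFourierLaplace (uDiffr ω₀ α f ρ φ) ω
      (-(profileHat ω₀ f ω / (4 * Real.pi)) *
        ((∫ β, sechExp ω ρ (φ - α) β) - ∫ β, sechExp ω ρ (φ + α) β)) := by
  have him := integrable_sechExp hω hρ hm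
  have hip := integrable_sechExp hω hρ hp
  have hk : ∀ β : ℝ, kernelPolar α β φ * Complex.exp (Complex.I * ω * (ρ * Real.cosh β : ℝ))
      = 2 * Complex.I * (sechExp ω ρ (φ - α) β - sechExp ω ρ (φ + α) β) := by
    intro β
    rw [kernelPolar_eq α φ β hm hp, sechExp, sechExp]
    ring
  have key : HasFourierLaplace _ ω _ := fourierLaplace_superposition hf ω₀ hω
    (τ := fun β => ρ * Real.cosh β)
    (fun β => mul_pos hρ (Real.cosh_pos β)) (by fun_prop) (k := fun β => kernelPolar α β φ)
    (((him.sub hip).const_mul (2 * Complex.I)).congr (Eventually.of_forall fun β => (hk β).symm))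
  rw [integral_congr_ae (Eventually.of_forall hk), integral_const_mul, integral_sub him hip] at key
  have h := key.const_mul (Complex.I / (8 * Real.pi))
  refine ⟨h.1, Eq.trans h.2 ?_⟩
  have hπ : (Real.pi : ℂ) ≠ 0 := by exact_mod_cast Real.pi_ne_zero
  field_simp
  linear_combination (8 * profileHat ω₀ f ω * ((∫ β, sechExp ω ρ (φ - α) β)
    - ∫ β, sechExp ω ρ (φ + α) β)) * Complex.I_sq

theorem hasFourierLaplace_modulated_sub (ω₀ : ℝ) {f : ℝ → ℂ} (hf : IsProfile f) {ω : ℂ}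
    (hω : 0 < ω.im) {y : ℝ} (hy : y < 0) :
    HasFourierLaplace (fun t => -modulated ω₀ f (t - -y)) ω
      (-(profileHat ω₀ f ω * Complex.exp (-(Complex.I * ω) * (y : ℝ)))) := by
  have h := fourierLaplace_shift hf ω₀ hω (neg_pos.2 hy)
  have e : Complex.I * ω * ((-y : ℝ) : ℂ) = -(Complex.I * ω) * (y : ℝ) := by push_cast; ring
  rw [e] at h
  simpa only [neg_one_mul] using HasFourierLaplace.const_mul h (-1)

/-- The stationary scattered field in closed form. -/
def scatHat (ω₀ α : ℝ) (f : ℝ → ℂ) (ω κ : ℂ) (x : Plane) : ℂ :=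
  -(profileHat ω₀ f ω / 2) * (edgeWave ω α (κ * (1 : ℝ)) x + edgeWave ω (-α) (κ * (-1 : ℝ)) x)

theorem hasFourierLaplace_uScat {α : ℝ} (hα₁ : Real.pi / 2 < α) (hα₂ : α < Real.pi) (ω₀ : ℝ)
    {f : ℝ → ℂ} (hf : IsProfile f) {ω κ : ℂ} (hω : 0 < ω.im) (hκ : κ ^ 2 = -2 * Complex.I * ω)
    (hκ₀ : 0 < κ.re) {ρ φ : ℝ} (hρ : 0 < ρ) (h0 : 0 < φ) (h1 : φ < 2 * Real.pi)
    (hp : φ ≠ phiPlus α) (hm : φ ≠ phiMinus α) :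
    HasFourierLaplace (uScat ω₀ α f ρ φ) ω (scatHat ω₀ α f ω κ (polarPt ρ φ)) := by
  have hcosα : Real.cos α < 0 := Real.cos_neg_of_pi_div_two_lt_of_lt hα₁ (by linarith)
  have hκ2 : 0 < (κ ^ 2).re := by rw [hκ]; simpa using hω
  set c₁ := Real.cos ((φ - α) / 2) with hc₁
  set c₂ := Real.cos ((φ + α) / 2) with hc₂
  have hc₁0 : c₁ ≠ 0 := by
    rcases hp.lt_or_gt with h | h
    · exact (cos_half_sub_pos hα₂ h0 h).ne'
    · exact (cos_half_sub_neg hα₁ h1 h).ne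
  have hc₂0 : c₂ ≠ 0 := by
    rcases hm.lt_or_gt with h | h
    · exact (cos_half_add_pos hα₁ h0 h).ne'
    · exact (cos_half_add_neg hα₂ h1 h).ne
  set E₁ := Complex.exp (-(Complex.I * ω) * (ρ * Real.cos (φ - α) : ℝ)) with hE₁
  set E₂ := Complex.exp (-(Complex.I * ω) * (ρ * Real.cos (φ + α) : ℝ)) with hE₂
  -- Plane-wave transforms are written with indicators of `c₁ < 0` and `c₂ < 0`, to match the jump
  -- term of `lorentzGauss_eq_of_ne_zero`.
  have hinc : HasFourierLaplace
      (fun t => uInc0 ω₀ α f ρ φ t - uInc ω₀ α f (polarPt ρ φ) t) ω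
      (-(profileHat ω₀ f ω * E₁) * if c₁ < 0 then 1 else 0) := by
    rcases hp.lt_or_gt with h | h
    · rw [if_neg (cos_half_sub_pos hα₂ h0 h).not_gt, mul_zero]
      simpa [uInc0, h] using hasFourierLaplace_zero ω
    · rw [if_pos (cos_half_sub_neg hα₁ h1 h), mul_one]
      have := hasFourierLaplace_modulated_sub ω₀ hf hω
        (mul_neg_of_pos_of_neg hρ ((cos_sub_le hα₁ hα₂ h1 h.le).trans_lt hcosα))
      simpa only [uInc0, if_neg h.not_gt, uInc, inner_dirInc_polarPt, zero_sub] using this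
  have hrefl : HasFourierLaplace (uRefl ω₀ α f ρ φ) ω
      (-(profileHat ω₀ f ω * E₂) * (1 - if c₂ < 0 then 1 else 0)) := by
    rcases hm.lt_or_gt with h | h
    · rw [if_neg (cos_half_add_pos hα₁ h0 h).not_gt, sub_zero, mul_one]
      have := hasFourierLaplace_modulated_sub ω₀ hf hω
        (mul_neg_of_pos_of_neg hρ ((cos_add_le hα₁ hα₂ h0 h.le).trans_lt hcosα))
      have hu : uRefl ω₀ α f ρ φ = fun t => -modulated ω₀ f (t - -(ρ * Real.cos (φ + α))) := by
        ext t
        rw [uRefl, if_pos h, inner_dirRefl_polarPt]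
      rw [hu]
      exact this
    · rw [if_pos (cos_half_add_neg hα₂ h1 h), sub_self, mul_zero]
      have hu : uRefl ω₀ α f ρ φ = fun t => 0 := by
        ext t
        rw [uRefl, if_neg h.not_gt]
      rw [hu]
      exact hasFourierLaplace_zero ω
  have hd := hasFourierLaplace_uDiffr ω₀ hf hω hρ hc₁0 hc₂0
  rw [integral_sechExp hω hρ hc₁0, integral_sechExp hω hρ hc₂0, ← hc₁, ← hc₂, ← hκ,
    lorentzGauss_eq_of_ne_zero hc₁0 hκ₀ hκ2 hρ.le, lorentzGauss_eq_of_ne_zero hc₂0 hκ₀ hκ2 hρ.le,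
    neg_mul Complex.I ω, ← hE₁, ← hE₂] at hd
  -- The indicators cancel. The reflected term leaves `2 - cerfc`, which is `cerfc` of the opposite
  -- argument; this is why the second wave in `scatHat` carries `-κ`.
  convert (hinc.add hrefl).add hd using 1
  · ext t
    rw [uScat, uTotal]
    ring
  · rw [scatHat, edgeWave, edgeWave, re_exp_mul_toC_polarPt, re_exp_mul_toC_polarPt,
      re_branch_polarPt hρ h0 h1, re_branch_polarPt hρ h0 h1, sub_neg_eq_add, ← hE₁, ← hE₂, ← hc₁,
      ← hc₂]
    have e1 : κ * ((1 : ℝ) : ℂ) * ((√ρ * c₁ : ℝ) : ℂ) = κ * ((√ρ * c₁ : ℝ) : ℂ) := by simp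
    have e2 : κ * ((-1 : ℝ) : ℂ) * ((√ρ * c₂ : ℝ) : ℂ) = -(κ * ((√ρ * c₂ : ℝ) : ℂ)) := by
      push_cast; ring
    rw [e1, e2, cerfc_neg]
    have hπ : (Real.pi : ℂ) ≠ 0 := by exact_mod_cast Real.pi_ne_zero
    have e3 : ∀ (c : ℝ), (if c < 0 then (2 : ℂ) else 0) = 2 * if c < 0 then 1 else 0 := by
      intro c; split_ifs <;> simp
    rw [e3, e3]
    field_simp
    ring

/-! ### Smoothness, equation and bounds for the closed form. -/

theorem exists_sq_eq_re_pos {z : ℂ} (hz : 0 < z.re) : ∃ κ : ℂ, κ ^ 2 = z ∧ 0 < κ.re := by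
  obtain ⟨κ, hκ⟩ := IsAlgClosed.exists_pow_nat_eq z two_pos
  have h0 : κ.re ≠ 0 := by
    intro h
    rw [← hκ, sq, Complex.mul_re, h] at hz
    nlinarith [sq_nonneg κ.im]
  rcases h0.lt_or_gt with h | h
  · exact ⟨-κ, by rw [neg_sq, hκ], by simpa using h⟩
  · exact ⟨κ, hκ, h⟩

theorem contDiffAt_scatHat (ω₀ α : ℝ) (f : ℝ → ℂ) (ω κ : ℂ) {x : Plane} (hx : x ∈ Q)
    {n : WithTop ℕ∞} : ContDiffAt ℝ n (scatHat ω₀ α f ω κ) x :=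
  contDiffAt_const.mul ((contDiffAt_edgeWave hx ω α _).add (contDiffAt_edgeWave hx ω (-α) _))

theorem sq_mul_unit {κ ω : ℂ} (hκ : κ ^ 2 = -2 * Complex.I * ω) {ε : ℝ} (hε : ε ^ 2 = 1) :
    (κ * (ε : ℝ)) ^ 2 = -2 * Complex.I * ω := by
  rw [mul_pow, ← Complex.ofReal_pow, hε, Complex.ofReal_one, mul_one, hκ]

theorem laplacian_scatHat (ω₀ α : ℝ) (f : ℝ → ℂ) {ω κ : ℂ} (hκ : κ ^ 2 = -2 * Complex.I * ω)
    {x : Plane} (hx : x ∈ Q) :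
    Laplacian.laplacian (scatHat ω₀ α f ω κ) x + ω ^ 2 * scatHat ω₀ α f ω κ x = 0 := by
  have hs : scatHat ω₀ α f ω κ = ContinuousLinearMap.mul ℝ ℂ (-(profileHat ω₀ f ω / 2)) ∘
      (edgeWave ω α (κ * (1 : ℝ)) + edgeWave ω (-α) (κ * (-1 : ℝ))) := by
    ext y
    simp [scatHat]
  have h1 := contDiffAt_edgeWave hx ω α (κ * (1 : ℝ)) (n := 2)
  have h2 := contDiffAt_edgeWave hx ω (-α) (κ * (-1 : ℝ)) (n := 2)
  have h12 : ContDiffAt ℝ 2 (edgeWave ω α (κ * (1 : ℝ)) + edgeWave ω (-α) (κ * (-1 : ℝ))) x :=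
    h1.add h2
  rw [hs, h12.laplacian_CLM_comp_left, Function.comp_apply, Function.comp_apply,
    h1.laplacian_add h2, laplacian_edgeWave hx (sq_mul_unit hκ (by norm_num)),
    laplacian_edgeWave hx (sq_mul_unit hκ (by norm_num))]
  simp only [ContinuousLinearMap.mul_apply', Pi.add_apply]
  ring

/-- The ray `φ = φ₊` separates the two alternatives of `norm_edgeWave_le`: below it `Re S > 0`,
beyond it `ℓ ≤ ρ cos α`. -/
theorem norm_edgeWave_plus_le {α : ℝ} (hα₁ : Real.pi / 2 < α) (hα₂ : α < Real.pi) {ω κ : ℂ}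
    (hω : 0 < ω.im) (hκ : κ ^ 2 = -2 * Complex.I * ω) (hκ₀ : 0 < κ.re) {x : Plane} (hx : x ∈ Q) :
    ‖edgeWave ω α (κ * (1 : ℝ)) x‖ ≤ 3 * Real.exp (-(ω.im * -Real.cos α) * ‖x‖) := by
  refine norm_edgeWave_le hx hκ hκ₀ hω α (by norm_num) (by linarith [Real.neg_one_le_cos α]) ?_
  obtain ⟨ρ, φ, hρ, h0, h1, rfl⟩ := exists_polarPt_of_mem_Q hx
  rw [re_branch_polarPt hρ h0 h1, re_exp_mul_toC_polarPt, norm_polarPt hρ]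
  rcases lt_or_ge φ (phiPlus α) with h | h
  · have := cos_half_sub_pos hα₂ h0 h
    exact Or.inl (by positivity)
  · refine Or.inr ?_
    rw [neg_neg, mul_comm (Real.cos α)]
    exact mul_le_mul_of_nonneg_left (cos_sub_le hα₁ hα₂ h1 h) hρ.le

theorem norm_edgeWave_minus_le {α : ℝ} (hα₁ : Real.pi / 2 < α) (hα₂ : α < Real.pi) {ω κ : ℂ}
    (hω : 0 < ω.im) (hκ : κ ^ 2 = -2 * Complex.I * ω) (hκ₀ : 0 < κ.re) {x : Plane} (hx : x ∈ Q) :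
    ‖edgeWave ω (-α) (κ * (-1 : ℝ)) x‖ ≤ 3 * Real.exp (-(ω.im * -Real.cos α) * ‖x‖) := by
  refine norm_edgeWave_le hx hκ hκ₀ hω (-α) (by norm_num) (by linarith [Real.neg_one_le_cos α]) ?_
  obtain ⟨ρ, φ, hρ, h0, h1, rfl⟩ := exists_polarPt_of_mem_Q hx
  rw [re_branch_polarPt hρ h0 h1, re_exp_mul_toC_polarPt, norm_polarPt hρ, sub_neg_eq_add]
  rcases lt_or_ge (phiMinus α) φ with h | h
  · have := cos_half_add_neg hα₂ h1 h
    refine Or.inl ?_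
    have := mul_nonneg (Real.sqrt_nonneg ρ) (neg_nonneg.2 this.le)
    linarith
  · refine Or.inr ?_
    rw [neg_neg, mul_comm (Real.cos α)]
    exact mul_le_mul_of_nonneg_left (cos_add_le hα₁ hα₂ h0 h) hρ.le

theorem exists_scatHat_bounds {α : ℝ} (hα₁ : Real.pi / 2 < α) (hα₂ : α < Real.pi) (ω₀ : ℝ)
    (f : ℝ → ℂ) {ω κ : ℂ} (hω : 0 < ω.im) (hκ : κ ^ 2 = -2 * Complex.I * ω) (hκ₀ : 0 < κ.re) :
    ∃ C c : ℝ, 0 < C ∧ 0 < c ∧ ∀ x ∈ Q,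
      ‖scatHat ω₀ α f ω κ x‖ ≤ C * Real.exp (-c * ‖x‖) ∧
      ∀ e : Plane, ‖fderiv ℝ (scatHat ω₀ α f ω κ) x e‖
        ≤ C * Real.exp (-c * ‖x‖) * ‖e‖ * (1 + ‖x‖ ^ (-(1 / 2) : ℝ)) := by
  have hcosα : Real.cos α < 0 := Real.cos_neg_of_pi_div_two_lt_of_lt hα₁ (by linarith)
  set P := ‖-(profileHat ω₀ f ω / 2)‖ with hP
  set K := 3 * (‖ω‖ + 2 / √Real.pi * ‖κ‖) with hK
  have hK0 : 0 ≤ K := by positivity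
  have hP0 : 0 ≤ P := norm_nonneg _
  -- The `6` is the bound `3` for each of two waves, and `2 * K` does the same for gradients. The `+
  -- 1` keeps the constant positive when the profile transform vanishes.
  refine ⟨P * (6 + 2 * K) + 1, ω.im * -Real.cos α, by positivity, mul_pos hω (neg_pos.2 hcosα),
    fun x hx => ?_⟩
  set B := Real.exp (-(ω.im * -Real.cos α) * ‖x‖) with hB
  have hB0 : 0 < B := Real.exp_pos _
  have b1 := norm_edgeWave_plus_le hα₁ hα₂ hω hκ hκ₀ hx
  have b2 := norm_edgeWave_minus_le hα₁ hα₂ hω hκ hκ₀ hx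
  rw [← hB] at b1 b2
  have hB' : Real.exp (-ω.im * ‖x‖) ≤ 3 * B := by
    have : Real.exp (-ω.im * ‖x‖) ≤ B := by
      refine Real.exp_le_exp.2 (mul_le_mul_of_nonneg_right ?_ (norm_nonneg x))
      nlinarith [Real.neg_one_le_cos α]
    linarith
  constructor
  · rw [scatHat, norm_mul, ← hP]
    have h := norm_add_le (edgeWave ω α (κ * (1 : ℝ)) x) (edgeWave ω (-α) (κ * (-1 : ℝ)) x)
    have h' : P * ‖edgeWave ω α (κ * (1 : ℝ)) x + edgeWave ω (-α) (κ * (-1 : ℝ)) x‖ ≤ P * (6 * B) :=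
      mul_le_mul_of_nonneg_left (by linarith) hP0
    have := mul_nonneg (mul_nonneg hP0 hK0) hB0.le
    linarith
  · intro e
    have n1 : ‖κ * ((1 : ℝ) : ℂ)‖ = ‖κ‖ := by simp
    have n2 : ‖κ * ((-1 : ℝ) : ℂ)‖ = ‖κ‖ := by simp
    have d1 := norm_fderiv_edgeWave_le hx (sq_mul_unit hκ (by norm_num)) α b1 hB' e
    have d2 := norm_fderiv_edgeWave_le hx (sq_mul_unit hκ (by norm_num)) (-α) b2 hB' e
    rw [n1] at d1
    rw [n2] at d2
    have g1 := (contDiffAt_edgeWave hx ω α (κ * (1 : ℝ)) (n := 1)).differentiableAt one_ne_zero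
    have g2 := (contDiffAt_edgeWave hx ω (-α) (κ * (-1 : ℝ)) (n := 1)).differentiableAt one_ne_zero
    have hfd : fderiv ℝ (scatHat ω₀ α f ω κ) x e = -(profileHat ω₀ f ω / 2)
        * (fderiv ℝ (edgeWave ω α (κ * (1 : ℝ))) x e
          + fderiv ℝ (edgeWave ω (-α) (κ * (-1 : ℝ))) x e) := by
      have := ((g1.hasFDerivAt.add g2.hasFDerivAt).const_mul (-(profileHat ω₀ f ω / 2))).fderiv
      exact DFunLike.congr_fun this e
    rw [hfd, norm_mul, ← hP]
    have hr : 0 ≤ 1 + ‖x‖ ^ (-(1 / 2) : ℝ) := by positivity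
    set R := B * ‖e‖ * (1 + ‖x‖ ^ (-(1 / 2) : ℝ)) with hR
    have hR0 : 0 ≤ R := by positivity
    have h := norm_add_le (fderiv ℝ (edgeWave ω α (κ * (1 : ℝ))) x e)
      (fderiv ℝ (edgeWave ω (-α) (κ * (-1 : ℝ))) x e)
    calc _ ≤ P * (2 * K * R) := by
          refine mul_le_mul_of_nonneg_left (h.trans ((add_le_add d1 d2).trans_eq ?_)) hP0
          rw [hK, hR]
          ring
      _ ≤ P * (2 * K * R) + (6 * P * R + R) := le_add_of_nonneg_right (by positivity)
      _ = _ := by rw [hR]; ring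

theorem contDiffOn_fderiv_apply {v : Plane → ℂ} (hv : ∀ x ∈ Q, ContDiffAt ℝ 3 v x)
    {w : Plane → Plane} (hw : ∀ x ∈ Q, ContDiffAt ℝ 2 w x) :
    ContDiffOn ℝ 2 (fun x => fderiv ℝ v x (w x)) Q := fun x hx =>
  (((hv x hx).fderiv_right (m := 2) (by norm_num)).clm_apply (hw x hx)).contDiffWithinAt

theorem norm_rotate (x : Plane) : ‖(!₂[-x 1, x 0] : Plane)‖ = ‖x‖ := by
  rw [EuclideanSpace.norm_eq, EuclideanSpace.norm_eq]
  simp [Fin.sum_univ_two, add_comm]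

end Sommerfeld

theorem mainTheorem3 (ω₀ α : ℝ) (hω₀ : 0 < ω₀) (hα₁ : Real.pi / 2 < α) (hα₂ : α < Real.pi)
    (f : ℝ → ℂ) (hf : Sommerfeld.IsProfile f) (ω : ℂ) (hω : 0 < ω.im) :
    ∃ v : Sommerfeld.Plane → ℂ,
      (∀ ρ φ : ℝ, 0 < ρ → 0 < φ → φ < 2 * Real.pi →
        φ ≠ Sommerfeld.phiPlus α → φ ≠ Sommerfeld.phiMinus α →
        Sommerfeld.FourierLaplaceConverges (Sommerfeld.uScat ω₀ α f ρ φ) ω ∧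
        v (Sommerfeld.polarPt ρ φ) = Sommerfeld.fourierLaplace (Sommerfeld.uScat ω₀ α f ρ φ) ω) ∧
      ContDiffOn ℝ 2 v Sommerfeld.Q ∧
      ContDiffOn ℝ 2 (Sommerfeld.dRho v) Sommerfeld.Q ∧
      ContDiffOn ℝ 2 (Sommerfeld.dPhi v) Sommerfeld.Q ∧
      (∃ C c : ℝ, 0 < C ∧ 0 < c ∧ ∀ x ∈ Sommerfeld.Q,
        ‖v x‖ ≤ C * Real.exp (-c * ‖x‖) ∧
        ‖Sommerfeld.dRho v x‖ ≤
          C * Real.exp (-c * ‖x‖) * (1 + ‖x‖ ^ (-(1 / 2) : ℝ)) ∧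
        ‖Sommerfeld.dPhi v x‖ ≤
          C * Real.exp (-c * ‖x‖) * ‖x‖ * (1 + ‖x‖ ^ (-(1 / 2) : ℝ))) ∧
      (∀ x ∈ Sommerfeld.Q, Laplacian.laplacian v x + ω ^ 2 * v x = 0) := by
  open Sommerfeld in
  -- The root exists because `Re (-2iω) = 2 Im ω > 0`.
  obtain ⟨κ, hκ, hκ₀⟩ := exists_sq_eq_re_pos (z := -2 * Complex.I * ω) (by simpa using hω)
  have hsmooth : ∀ x ∈ Q, ContDiffAt ℝ 3 (scatHat ω₀ α f ω κ) x :=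
    fun x hx => contDiffAt_scatHat ω₀ α f ω κ hx
  refine ⟨scatHat ω₀ α f ω κ, fun ρ φ hρ h0 h1 hp hm => ?_,
    fun x hx => (contDiffAt_scatHat ω₀ α f ω κ hx).contDiffWithinAt,
    contDiffOn_fderiv_apply hsmooth fun x hx => ?_, contDiffOn_fderiv_apply hsmooth fun x _ => ?_,
    ?_, fun x hx => laplacian_scatHat ω₀ α f hκ hx⟩
  · have := hasFourierLaplace_uScat hα₁ hα₂ ω₀ hf hω hκ hκ₀ hρ h0 h1 hp hm
    exact ⟨this.1, this.2.symm⟩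
  · have hx0 := norm_pos_of_mem_Q hx
    exact ((contDiffAt_norm ℝ (norm_pos_iff.1 hx0)).inv hx0.ne').smul contDiffAt_id
  · refine ContDiff.contDiffAt ?_
    rw [contDiff_euclidean]
    intro i
    fin_cases i
    · simpa using (contDiff_piLp_apply (𝕜 := ℝ) (n := 2) 2 (E := fun _ : Fin 2 => ℝ) (i := 1)).neg
    · simpa using contDiff_piLp_apply (𝕜 := ℝ) (n := 2) 2 (E := fun _ : Fin 2 => ℝ) (i := 0)
  · obtain ⟨C, c, hC, hc, h⟩ := exists_scatHat_bounds hα₁ hα₂ ω₀ f hω hκ hκ₀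
    refine ⟨C, c, hC, hc, fun x hx => ⟨(h x hx).1, ?_, ?_⟩⟩
    -- The radial direction is a unit vector; the angular one below has length `ρ`, which gives the
    -- extra factor in its bound.
    · have hx0 := norm_pos_of_mem_Q hx
      refine ((h x hx).2 (‖x‖⁻¹ • x)).trans_eq ?_
      rw [norm_smul, norm_inv, norm_norm, inv_mul_cancel₀ hx0.ne', mul_one]
    · refine ((h x hx).2 !₂[-x 1, x 0]).trans_eq ?_
      rw [norm_rotate]

end
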